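/- Work in the polar-coordinate model of the hyperbolic plane $\mathbb{H}^2$ with pole $O$: a point $P$ has a radius $r(P)\ge 0$ and an angle $\varphi(P)$, and $\cosh|PQ|=\cosh r(P)\cosh r(Q)-\sinh r(P)\sinh r(Q)\cos(\varphi(P)-\varphi(Q))$. Let $\mathcal S\subset\mathbb{H}^2$ be a finite set of sites and, for a sweep radius $\hat r$, let $\mathcal S_{\le \hat r}=\{S\in\mathcal S : r(S)\le\hat r\}$. The beach ellipse of a site $S\in\mathcal S_{\le\hat r}$ is $E_S=\{P : r(P)\le\hat r,\ |PS|=\hat r-r(P)\}$. Its active part $A(E_S)$ consists of those $P\in E_S$ for which there are no $S'\in\mathcal S_{\le\hat r}$ and $P'\in E_{S'}$ with $\varphi(P')=\varphi(P)$ and $r(P')>r(P)$. The beach curve is $\mathcal B=\bigcup_{S\in\mathcal S_{\le\hat r}}A(E_S)$. An active segment of $S$ at sweep radius $\hat r$ is a connected component of $A(E_S)$ with more than one point. For $r_1<r_2$, an active segment $C$ of $S$ at $\hat r=r_2$ continues an active segment $C'$ of $S$ at $\hat r=r_1$ if there is a continuous path $\gamma$ on $[r_1,r_2]$ with $\gamma(r_1)\in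 C'$ and $\gamma(r_2)\in C$ such that, for every $\hat r\in[r_1,r_2]$, $\gamma(\hat r)$ lies on an active segment of $S$ at sweep radius $\hat r$. A segment $C$ of $S$ at $r_2$ became active since $r_1$ if there is no active segment $C'$ of $S$ at $r_1$ such that $C$ is the one and only active segment of $S$ at $r_2$ that continues $C'$. A site event occurs when $\hat r=r(T)$ for some $T\in\mathcal S$. Then the following hold. (1) New segments become active only through site events: if $r_1<r_2$ and an active segment of a site $S$ at $r_2$ became active since $r_1$, then $r(T)\in[r_1,r_2]$ for some $T\in\mathcal S$. (2) If moreover the segment continues no active segment of $S$ at $r_1$ at all, then $r(S)\in[r_1,r_2]$, so that the site event of $S$ itself occurs. (3) Call $V$ a Voronoi vertex if it is the center of a circle with at least three sites on it and no site strictly inside, and let its far point $V'$ be a point of largest radius on this circle. Let $\bar{\mathcal Q}$ consist of $0$, $\infty$, the radii $r(S)$ of all sites (site events) and the radii $r(V')$ for all Voronoi vertices $V$ (true circle events), and let $r_i<r_j$ be consecutive in $\bar{\mathcal Q}$. Then for no $r\in(r_i,r_j)$ does a beach-ellipse intersection of two distinct sites $S,T\in\mathcal S$ enter the beach curve at $r$.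 That is, there are no $\varepsilon>0$ and no point $I(\hat r)\in E_S\cap E_T$ moving continuously with $\hat r\in[r-\varepsilon,r]$ such that $I(\hat r)\notin\mathcal B$ for all $\hat r\in[r-\varepsilon,r)$ and $I(r)\in\mathcal B$ at $\hat r=r$. -/

import Mathlib

noncomputable section

namespace HyperbolicSweep

/-- Hyperbolic distance in the polar-coordinate model of the hyperbolic plane. The point with
radius `r` and angle `φ` is represented by the complex number `r * exp (i φ)`; the pole is `0`,
the radius of `A` is `‖A‖` and its angle is `A.arg`. -/
def hypDist (A B : ℂ) : ℝ :=
  Real.arcosh (Real.cosh ‖A‖ * Real.cosh ‖B‖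
    - Real.sinh ‖A‖ * Real.sinh ‖B‖ * Real.cos (A.arg - B.arg))

/-- The hyperbolic circle with center `V` and radius `d`. -/
def hypCircle (V : ℂ) (d : ℝ) : Set ℂ := {Q | hypDist V Q = d}

/-- The sites contained in the sweep circle of radius `ρ` around the pole. -/
def seenSites (𝒮 : Finset ℂ) (ρ : ℝ) : Set ℂ := {S | S ∈ 𝒮 ∧ ‖S‖ ≤ ρ}

/-- The beach ellipse of `S` for the sweep radius `ρ`: the points equidistant from `S` and from
the sweep circle. A point `P` inside the sweep circle has distance `ρ - ‖P‖` to it. -/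
def beachEllipse (S : ℂ) (ρ : ℝ) : Set ℂ := {P | ‖P‖ ≤ ρ ∧ hypDist P S = ρ - ‖P‖}

/-- The active part of the beach ellipse of the site `S`: no point at the same angle on the
beach ellipse of a seen site is farther from the pole. -/
def activePart (𝒮 : Finset ℂ) (S : ℂ) (ρ : ℝ) : Set ℂ :=
  {P | P ∈ beachEllipse S ρ ∧
    ¬ ∃ S' ∈ seenSites 𝒮 ρ, ∃ P' ∈ beachEllipse S' ρ, P.arg = P'.arg ∧ ‖P‖ < ‖P'‖}

/-- The beach curve for the sweep radius `ρ`. -/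
def beachCurve (𝒮 : Finset ℂ) (ρ : ℝ) : Set ℂ := ⋃ S ∈ seenSites 𝒮 ρ, activePart 𝒮 S ρ

/-- `V` is a Voronoi vertex with witness circle of radius `d`: no site is closer to `V` than `d`,
and at least three sites are at distance `d`. -/
def IsVoronoiVertex (𝒮 : Finset ℂ) (V : ℂ) (d : ℝ) : Prop :=
  (∀ S ∈ 𝒮, d ≤ hypDist V S) ∧ 3 ≤ {S : ℂ | S ∈ 𝒮 ∧ hypDist V S = d}.ncard

/-- `V'` is a point of maximal radius on the circle with center `V` and radius `d`. -/
def IsFarPoint (V : ℂ) (d : ℝ) (V' : ℂ) : Prop :=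
  V' ∈ hypCircle V d ∧ ∀ Q ∈ hypCircle V d, ‖Q‖ ≤ ‖V'‖

/-- The radii of the site events and of the true circle events, together with `0` and `∞`. -/
def eventRadii (𝒮 : Finset ℂ) : Set EReal :=
  {0, ⊤} ∪ {q | ∃ S ∈ 𝒮, q = ((‖S‖ : ℝ) : EReal)} ∪
    {q | ∃ V d V', IsVoronoiVertex 𝒮 V d ∧ IsFarPoint V d V' ∧ q = ((‖V'‖ : ℝ) : EReal)}

/-- Some intersection of the beach ellipses of `S` and `T`, regarded as a point that moves
continuously with the sweep radius, enters the beach curve at the sweep radius `r`. -/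
def IntersectionEntersAt (𝒮 : Finset ℂ) (S T : ℂ) (r : ℝ) : Prop :=
  ∃ ε > 0, ∃ I : ℝ → ℂ, ContinuousOn I (Set.Icc (r - ε) r) ∧
    (∀ ρ ∈ Set.Icc (r - ε) r, I ρ ∈ beachEllipse S ρ ∩ beachEllipse T ρ) ∧
    (∀ ρ ∈ Set.Ico (r - ε) r, I ρ ∉ beachCurve 𝒮 ρ) ∧ I r ∈ beachCurve 𝒮 r

/-- The active beach ellipse segments of `S`: the maximal connected pieces of the active part.
A piece that has shrunk to a single point counts as vanished. -/
def activeSegments (𝒮 : Finset ℂ) (S : ℂ) (ρ : ℝ) : Set (Set ℂ) :=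
  {C | C.Nontrivial ∧ ∃ P ∈ activePart 𝒮 S ρ, C = connectedComponentIn (activePart 𝒮 S ρ) P}

/-- The segment `C` of `S` at sweep radius `r₂` continues the segment `C'` of `S` at sweep radius
`r₁`: while the sweep radius grows from `r₁` to `r₂`, a point can move continuously from `C'`
to `C` and stay on active segments of `S` all the time. -/
def Continues (𝒮 : Finset ℂ) (S : ℂ) (r₁ : ℝ) (C' : Set ℂ) (r₂ : ℝ) (C : Set ℂ) : Prop :=
  ∃ γ : ℝ → ℂ, ContinuousOn γ (Set.Icc r₁ r₂) ∧
    (∀ ρ ∈ Set.Icc r₁ r₂, ∃ D ∈ activeSegments 𝒮 S ρ, γ ρ ∈ D) ∧ γ r₁ ∈ C' ∧ γ r₂ ∈ C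

/-- The active segment `C` of `S` at sweep radius `r₂` has become active since the sweep radius
was `r₁`: it is not the unique continuation of a segment of `S` that was active at `r₁`. So it
either continues no earlier segment, or is one of several parts of an earlier segment. -/
def BecameActive (𝒮 : Finset ℂ) (S : ℂ) (r₁ r₂ : ℝ) (C : Set ℂ) : Prop :=
  C ∈ activeSegments 𝒮 S r₂ ∧
    ¬ ∃ C' ∈ activeSegments 𝒮 S r₁, Continues 𝒮 S r₁ C' r₂ C ∧
      ∀ D ∈ activeSegments 𝒮 S r₂, Continues 𝒮 S r₁ C' r₂ D → D = C

end HyperbolicSweep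

end

open HyperbolicSweep

/-!
In a fixed direction `e`, the hyperbolic cotangent of the radius of the beach ellipse of `S` is an
affine function of `e`. So the beach curve corresponds to the lower envelope of finitely many
affine functions on the unit circle, and a point of a beach ellipse is active exactly if its site
is one of the nearest sites.

In the Klein model bisectors are hyperplanes. So, if `S` has been swept before `r₁`, a point of an
active segment at `r₂` can be pushed along the geodesic towards `S` as the ellipse shrinks, without
leaving the Voronoi cell of `S`. This joins every active segment to an earlier one. Conversely, for
every other swept site `T` there is a direction, independent of the sweep radius, in which `T`
hides `S`; a segment of `S` never passes it, so it cannot split before the next site event.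

An intersection of two beach ellipses that enters the beach curve at `r` must be equidistant from
a third nearest site at that moment, for otherwise it would have been active shortly before. It is
then a Voronoi vertex `V` with circle radius `r - r(V)`, whose far point has radius `r`.
-/

noncomputable section

namespace HyperbolicSweep

open NormedSpace Set Filter Topology
open scoped InnerProductSpace

local notation "dir" => NormedSpace.normalize

section Polar

variable {E : Type*} [NormedAddCommGroup E] [InnerProductSpace ℝ E] {A B P S T z : E}

/-- The map that applies `f` to the radius in polar coordinates and keeps the direction. -/
def radial (f : ℝ → ℝ) (z : E) : E := f ‖z‖ • dir z

@[simp]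
lemma radial_zero (f : ℝ → ℝ) : radial f (0 : E) = 0 := by
  simp [radial]

lemma norm_radial {f : ℝ → ℝ} (hf₀ : f 0 = 0) (hf : 0 ≤ f ‖z‖) : ‖radial f z‖ = f ‖z‖ := by
  rcases eq_or_ne z 0 with rfl | hz
  · simp [hf₀]
  · rw [radial, norm_smul, norm_normalize hz, mul_one, Real.norm_of_nonneg hf]

lemma normalize_radial {f : ℝ → ℝ} (hf : 0 < f ‖z‖) :
    dir (radial f z) = dir z := by
  rw [radial, normalize_smul_of_pos hf, normalize_normalize]

lemma radial_radial {f g : ℝ → ℝ} (hf : 0 < ‖z‖ → 0 < f ‖z‖) (hgf : g (f ‖z‖) = ‖z‖) :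
    radial g (radial f z) = z := by
  rcases eq_or_ne z 0 with rfl | hz
  · simp
  · have hfz := hf (norm_pos_iff.2 hz)
    have hnorm : ‖radial f z‖ = f ‖z‖ := by
      rw [radial, norm_smul, norm_normalize hz, mul_one, Real.norm_of_nonneg hfz.le]
    rw [radial, hnorm, hgf, normalize_radial hfz, norm_smul_normalize]

lemma continuousAt_normalize (hz : z ≠ 0) : ContinuousAt (dir : E → E) z :=
  (continuous_norm.continuousAt.inv₀ (norm_ne_zero_iff.2 hz)).smul continuousAt_id

lemma continuousAt_radial {f : ℝ → ℝ} (hf₀ : f 0 = 0) (hf : ContinuousAt f ‖z‖) :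
    ContinuousAt (radial f) z := by
  rcases eq_or_ne z 0 with rfl | hz
  · rw [ContinuousAt, radial_zero, tendsto_zero_iff_norm_tendsto_zero]
    have hf' : Tendsto (fun w : E => |f ‖w‖|) (𝓝 0) (𝓝 0) := by
      simpa [hf₀] using (hf.comp (f := fun w : E => ‖w‖) continuous_norm.continuousAt).abs.tendsto
    refine squeeze_zero (fun _ => norm_nonneg _) (fun w => ?_) hf'
    rcases eq_or_ne w 0 with rfl | hw
    · simp
    · rw [radial, norm_smul, norm_normalize hw, mul_one, Real.norm_eq_abs]
  · exact (hf.comp continuous_norm.continuousAt).smul (continuousAt_normalize hz)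

lemma sameRay_iff_normalize_eq (hA : A ≠ 0) (hB : B ≠ 0) :
    SameRay ℝ A B ↔ dir A = dir B :=
  sameRay_iff_inv_norm_smul_eq_of_ne hA hB

/-- The space-like coordinates, in the hyperboloid model, of the point with polar coordinates
`A`. -/
def sinhVec (A : E) : E := radial Real.sinh A

lemma norm_sinhVec (A : E) : ‖sinhVec A‖ = Real.sinh ‖A‖ :=
  norm_radial Real.sinh_zero (Real.sinh_nonneg_iff.2 (norm_nonneg A))

lemma sinhVec_injective : Function.Injective (sinhVec : E → E) :=
  Function.LeftInverse.injective (g := radial Real.arsinh) fun _ =>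
    radial_radial Real.sinh_pos_iff.2 (Real.arsinh_sinh _)

lemma continuous_sinhVec : Continuous (sinhVec : E → E) :=
  continuous_iff_continuousAt.2 fun _ =>
    continuousAt_radial Real.sinh_zero Real.continuous_sinh.continuousAt

lemma sameRay_sinhVec_iff : SameRay ℝ (sinhVec A) (sinhVec B) ↔ SameRay ℝ A B := by
  rcases eq_or_ne A 0 with rfl | hA
  · simp [sinhVec]
  rcases eq_or_ne B 0 with rfl | hB
  · simp [sinhVec]
  have sinhVec_ne {C : E} (hC : C ≠ 0) : sinhVec C ≠ 0 := by
    rw [← norm_ne_zero_iff, norm_sinhVec, Real.sinh_ne_zero]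
    exact norm_ne_zero_iff.2 hC
  rw [sameRay_iff_normalize_eq (sinhVec_ne hA) (sinhVec_ne hB), sameRay_iff_normalize_eq hA hB,
    sinhVec, sinhVec, normalize_radial (Real.sinh_pos_iff.2 (norm_pos_iff.2 hA)),
    normalize_radial (Real.sinh_pos_iff.2 (norm_pos_iff.2 hB))]

/-- The hyperbolic cosine of the hyperbolic distance between the points with polar coordinates
`A` and `B`. -/
def coshDist (A B : E) : ℝ := Real.cosh ‖A‖ * Real.cosh ‖B‖ - ⟪sinhVec A, sinhVec B⟫_ℝ

@[fun_prop]
lemma continuous_coshDist_left (B : E) : Continuous fun A => coshDist A B := by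
  have := continuous_sinhVec (E := E)
  unfold coshDist
  fun_prop

lemma coshDist_self (A : E) : coshDist A A = 1 := by
  rw [coshDist, real_inner_self_eq_norm_sq, norm_sinhVec, ← Real.cosh_sq_sub_sinh_sq ‖A‖]
  ring

lemma cosh_norm_sub_le_coshDist (A B : E) : Real.cosh (‖A‖ - ‖B‖) ≤ coshDist A B := by
  have := real_inner_le_norm (sinhVec A) (sinhVec B)
  rw [norm_sinhVec, norm_sinhVec] at this
  rw [Real.cosh_sub, coshDist]
  linarith

lemma coshDist_eq_cosh_norm_sub_iff :
    coshDist A B = Real.cosh (‖A‖ - ‖B‖) ↔ SameRay ℝ A B := by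
  rw [← sameRay_sinhVec_iff, sameRay_iff_norm_smul_eq, ← inner_eq_norm_mul_iff_real, norm_sinhVec,
    norm_sinhVec, Real.cosh_sub, coshDist, sub_right_inj, real_inner_comm, mul_comm]

lemma one_le_coshDist (A B : E) : 1 ≤ coshDist A B :=
  (Real.one_le_cosh _).trans (cosh_norm_sub_le_coshDist A B)

lemma one_lt_coshDist (hne : A ≠ B) : 1 < coshDist A B := by
  refine (one_le_coshDist A B).lt_of_ne fun heq => hne ?_
  have hcosh : Real.cosh (‖A‖ - ‖B‖) = 1 :=
    ((cosh_norm_sub_le_coshDist A B).trans_eq heq.symm).antisymm (Real.one_le_cosh _)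
  rw [← hcosh, eq_comm, coshDist_eq_cosh_norm_sub_iff] at heq
  have hnorm : ‖A‖ - ‖B‖ = 0 := by
    by_contra h
    exact (Real.one_lt_cosh.2 h).ne' hcosh
  exact (sameRay_iff_of_norm_eq (sub_eq_zero.1 hnorm)).1 heq

lemma coshDist_neg_right (A B : E) :
    coshDist A (-B) = Real.cosh (‖A‖ + ‖B‖) + Real.cosh (‖A‖ - ‖B‖) - coshDist A B := by
  have : sinhVec (-B) = -sinhVec B := by simp [sinhVec, radial]
  rw [coshDist, coshDist, this, norm_neg, inner_neg_right, Real.cosh_add, Real.cosh_sub]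
  ring

lemma coshDist_le_cosh_norm_add (A B : E) : coshDist A B ≤ Real.cosh (‖A‖ + ‖B‖) := by
  have := cosh_norm_sub_le_coshDist A (-B)
  rw [coshDist_neg_right, norm_neg] at this
  linarith

lemma coshDist_eq_cosh_norm_add_iff :
    coshDist A B = Real.cosh (‖A‖ + ‖B‖) ↔ SameRay ℝ A (-B) := by
  rw [← coshDist_eq_cosh_norm_sub_iff, coshDist_neg_right, norm_neg]
  constructor <;> intro h <;> linarith

lemma coshDist_lt_coshDist_of_sameRay_neg (hP : P ≠ 0) (hPS : SameRay ℝ P (-S))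
    (hTS : ‖T‖ ≤ ‖S‖) (hne : T ≠ S) : coshDist P T < coshDist P S := by
  rw [coshDist_eq_cosh_norm_add_iff.2 hPS]
  have hP₀ := norm_nonneg P
  have hT₀ := norm_nonneg T
  have hmono : Real.cosh (‖P‖ + ‖T‖) ≤ Real.cosh (‖P‖ + ‖S‖) :=
    Real.cosh_le_cosh.2 (by
      rw [abs_of_nonneg (by positivity), abs_of_nonneg (by positivity)]; linarith)
  refine (coshDist_le_cosh_norm_add P T).trans hmono |>.lt_of_ne fun heq => hne ?_
  have hPT : SameRay ℝ P (-T) := coshDist_eq_cosh_norm_add_iff.1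
    ((coshDist_le_cosh_norm_add P T).antisymm (hmono.trans_eq heq.symm))
  have hcosh := hmono.antisymm (heq.symm.trans_le (coshDist_le_cosh_norm_add P T))
  have hnorm : ‖T‖ = ‖S‖ := by
    have := Real.cosh_injOn (add_nonneg hP₀ hT₀) (add_nonneg hP₀ (norm_nonneg S)) hcosh
    linarith
  have hTS' : SameRay ℝ (-T) (-S) := hPT.symm.trans hPS fun h => absurd h hP
  exact neg_injective ((sameRay_iff_of_norm_eq (by simpa using hnorm)).1 hTS')

end Polar

lemma cosh_sub_cosh_pos {a b : ℝ} (ha : 0 ≤ a) (hab : a < b) : 0 < Real.cosh b - Real.cosh a :=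
  sub_pos.2 (Real.cosh_strictMonoOn ha (ha.trans hab.le) hab)

lemma tanh_strictMono : StrictMono Real.tanh := fun x y hxy => by
  rw [← Real.artanh_lt_artanh_iff ⟨Real.neg_one_lt_tanh x, Real.tanh_lt_one x⟩
    ⟨Real.neg_one_lt_tanh y, Real.tanh_lt_one y⟩, Real.artanh_tanh, Real.artanh_tanh]
  exact hxy

lemma tanh_pos {x : ℝ} (hx : 0 < x) : 0 < Real.tanh x :=
  Real.tanh_zero.symm.trans_lt (tanh_strictMono hx)

lemma continuousAt_artanh {x : ℝ} (hx : x ∈ Ioo (-1) 1) : ContinuousAt Real.artanh x :=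
  Real.strictMonoOn_artanh.continuousAt_of_image_mem_nhds (Ioo_mem_nhds hx.1 hx.2) <| by
    rw [Real.artanh_bijOn.image_eq]
    exact univ_mem

section Klein

variable {E : Type*} [NormedAddCommGroup E] [InnerProductSpace ℝ E] {S e y : E} {ρ t : ℝ}

/-- The position in the Klein model, the unit ball in which hyperbolic lines are chords, of the
point with polar coordinates `A`. -/
def klein (A : E) : E := radial Real.tanh A

/-- The polar coordinates of the point `y` of the Klein model. -/
def ofKlein (y : E) : E := radial Real.artanh y

lemma norm_klein (A : E) : ‖klein A‖ = Real.tanh ‖A‖ :=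
  norm_radial Real.tanh_zero <|
    Real.tanh_zero.symm.trans_le (tanh_strictMono.monotone (norm_nonneg A))

lemma norm_klein_lt_one (A : E) : ‖klein A‖ < 1 :=
  (norm_klein A).trans_lt (Real.tanh_lt_one _)

lemma ofKlein_klein (A : E) : ofKlein (klein A) = A :=
  radial_radial (fun hA => tanh_pos hA) (Real.artanh_tanh _)

lemma klein_ofKlein (hy : ‖y‖ < 1) : klein (ofKlein y) = y :=
  radial_radial (fun h => Real.artanh_pos ⟨h, hy⟩)
    (Real.tanh_artanh ⟨by linarith [norm_nonneg y], hy⟩)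

lemma normalize_ofKlein (hy₀ : y ≠ 0) (hy : ‖y‖ < 1) : dir (ofKlein y) = dir y :=
  normalize_radial (Real.artanh_pos ⟨norm_pos_iff.2 hy₀, hy⟩)

lemma continuousAt_ofKlein (hy : ‖y‖ < 1) : ContinuousAt (ofKlein : E → E) y :=
  continuousAt_radial Real.artanh_zero
    (continuousAt_artanh ⟨by linarith [norm_nonneg y], hy⟩)

lemma cosh_smul_klein (A : E) : Real.cosh ‖A‖ • klein A = sinhVec A := by
  rw [klein, sinhVec, radial, radial, smul_smul, Real.tanh_eq_sinh_div_cosh,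
    mul_div_cancel₀ _ (Real.cosh_pos _).ne']

lemma coshDist_eq_cosh_mul (A B : E) :
    coshDist A B = Real.cosh ‖A‖ * (Real.cosh ‖B‖ - ⟪klein A, sinhVec B⟫_ℝ) := by
  rw [coshDist, ← cosh_smul_klein A, real_inner_smul_left]
  ring

/-- Up to the factor `cosh ‖P‖`, the value at `klein P` is `coshDist P S - cosh (ρ - ‖P‖)`. So the
beach ellipse of `S` at sweep radius `ρ` is the zero set of this convex function. -/
def kleinGap (S : E) (ρ : ℝ) (y : E) : ℝ :=
  Real.sinh ρ * ‖y‖ - ⟪y, sinhVec S⟫_ℝ - (Real.cosh ρ - Real.cosh ‖S‖)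

lemma cosh_mul_kleinGap_klein (P S : E) (ρ : ℝ) :
    Real.cosh ‖P‖ * kleinGap S ρ (klein P) = coshDist P S - Real.cosh (ρ - ‖P‖) := by
  have hsinh : Real.cosh ‖P‖ * ‖klein P‖ = Real.sinh ‖P‖ := by
    rw [norm_klein, Real.tanh_eq_sinh_div_cosh, mul_div_cancel₀ _ (Real.cosh_pos _).ne']
  rw [coshDist_eq_cosh_mul, Real.cosh_sub, kleinGap, ← hsinh]
  ring

lemma convexOn_kleinGap (S : E) (hρ : 0 ≤ ρ) : ConvexOn ℝ univ (kleinGap S ρ) := by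
  have hnorm : ConvexOn ℝ univ fun y : E => Real.sinh ρ * ‖y‖ :=
    convexOn_univ_norm.smul (Real.sinh_nonneg_iff.2 hρ)
  have hinner : ConcaveOn ℝ univ fun y : E => ⟪y, sinhVec S⟫_ℝ :=
    ((innerₗ E).flip (sinhVec S)).concaveOn convex_univ
  exact (hnorm.sub hinner).sub (concaveOn_const _ convex_univ)

lemma continuous_kleinGap (S : E) :
    Continuous fun q : ℝ × E => kleinGap S q.1 q.2 := by
  unfold kleinGap
  fun_prop

/-- The hyperbolic cotangent of the radius, in direction `e`, of the beach ellipse of `S` at sweep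
radius `ρ`. It is affine in `e`, so that the beach curve is the lower envelope of affine
functions on the unit circle. -/
def ellipseCoth (S : E) (ρ : ℝ) : E →ᵃ[ℝ] ℝ :=
  (Real.cosh ρ - Real.cosh ‖S‖)⁻¹ •
    (AffineMap.const ℝ E (Real.sinh ρ) - ((innerₗ E).flip (sinhVec S)).toAffineMap)

lemma ellipseCoth_apply (S : E) (ρ : ℝ) (e : E) :
    ellipseCoth S ρ e =
      (Real.sinh ρ - ⟪e, sinhVec S⟫_ℝ) / (Real.cosh ρ - Real.cosh ‖S‖) := by
  rw [div_eq_inv_mul]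
  rfl

lemma kleinGap_smul (hS : ‖S‖ < ρ) (he : ‖e‖ = 1) (ht : 0 ≤ t) :
    kleinGap S ρ (t • e) =
      (Real.cosh ρ - Real.cosh ‖S‖) * (t * ellipseCoth S ρ e - 1) := by
  have := (cosh_sub_cosh_pos (norm_nonneg S) hS).ne'
  rw [kleinGap, ellipseCoth_apply, norm_smul, he, real_inner_smul_left, Real.norm_of_nonneg ht]
  field_simp

lemma one_lt_ellipseCoth (hS : ‖S‖ < ρ) (he : ‖e‖ = 1) : 1 < ellipseCoth S ρ e := by
  have hinner := real_inner_le_norm e (sinhVec S)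
  rw [he, one_mul, norm_sinhVec] at hinner
  have hexp := Real.exp_lt_exp.2 (neg_lt_neg hS)
  rw [ellipseCoth_apply, one_lt_div (cosh_sub_cosh_pos (norm_nonneg S) hS)]
  rw [← Real.cosh_sub_sinh, ← Real.cosh_sub_sinh] at hexp
  linarith

@[fun_prop]
lemma continuous_ellipseCoth (S : E) (ρ : ℝ) : Continuous (ellipseCoth S ρ) := by
  rw [funext (ellipseCoth_apply S ρ)]
  fun_prop

lemma ellipseCoth_injOn (ρ : ℝ) :
    InjOn (fun S : E => ellipseCoth S ρ) (Metric.ball 0 ρ) := by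
  intro S hS T hT heq
  simp only [mem_ball_zero_iff] at hS hT
  have hρ : Real.sinh ρ ≠ 0 := Real.sinh_ne_zero.2 ((norm_nonneg S).trans_lt hS).ne'
  have hS' := (cosh_sub_cosh_pos (norm_nonneg S) hS).ne'
  have happly (e : E) := DFunLike.congr_fun heq e
  simp only [ellipseCoth_apply] at happly
  have hcosh : Real.cosh ρ - Real.cosh ‖S‖ = Real.cosh ρ - Real.cosh ‖T‖ := by
    simpa only [inner_zero_left, sub_zero, div_eq_mul_inv,
      mul_right_inj' hρ, inv_inj] using happly 0
  refine sinhVec_injective (ext_inner_left ℝ fun e => ?_)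
  simpa only [← hcosh, div_left_inj' hS', sub_right_inj] using happly e

end Klein

section VoronoiCell

variable {E : Type*} [NormedAddCommGroup E] [InnerProductSpace ℝ E] {𝒮 : Finset E}
  {P Q S : E} {t : ℝ}

/-- `P` is strictly closer to `S` than to every other site, that is, in the interior of the
Voronoi cell of `S`. -/
def StrictlyClosest (𝒮 : Finset E) (S P : E) : Prop :=
  ∀ T ∈ 𝒮, T ≠ S → coshDist P S < coshDist P T

lemma isOpen_setOf_strictlyClosest (𝒮 : Finset E) (S : E) :
    IsOpen {P | StrictlyClosest 𝒮 S P} := by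
  have : {P | StrictlyClosest 𝒮 S P} =
      ⋂ T ∈ 𝒮, ⋂ _ : T ≠ S, {P | coshDist P S < coshDist P T} := by
    ext
    simp [StrictlyClosest]
  rw [this]
  exact isOpen_biInter_finset fun T _ => isOpen_iInter_of_finite fun _ =>
    isOpen_lt (continuous_coshDist_left S) (continuous_coshDist_left T)

lemma strictlyClosest_self (𝒮 : Finset E) (S : E) : StrictlyClosest 𝒮 S S := fun T _ hne => by
  rw [coshDist_self]
  exact one_lt_coshDist hne.symm

lemma norm_lineMap_klein_lt_one (P Q : E) (ht : t ∈ Icc (0 : ℝ) 1) :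
    ‖AffineMap.lineMap (klein P) (klein Q) t‖ < 1 := by
  have hball {A : E} : klein A ∈ Metric.ball (0 : E) 1 := mem_ball_zero_iff.2 (norm_klein_lt_one A)
  exact mem_ball_zero_iff.1 ((convex_ball (0 : E) 1).lineMap_mem hball hball ht)

/-- Voronoi cells are convex in the Klein model, where bisectors are hyperplanes. -/
lemma StrictlyClosest.ofKlein_lineMap (hP : StrictlyClosest 𝒮 S P) (hQ : StrictlyClosest 𝒮 S Q)
    (ht : t ∈ Icc (0 : ℝ) 1) :
    StrictlyClosest 𝒮 S (ofKlein (AffineMap.lineMap (klein P) (klein Q) t)) := by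
  intro T hT hne
  let halfSpace : Set E := {y | ⟪y, sinhVec T - sinhVec S⟫_ℝ < Real.cosh ‖T‖ - Real.cosh ‖S‖}
  have hconvex : Convex ℝ halfSpace :=
    convex_halfSpace_lt ((innerₗ E).flip (sinhVec T - sinhVec S)).isLinear _
  have hmem (A : E) : klein A ∈ halfSpace ↔ coshDist A S < coshDist A T := by
    rw [coshDist_eq_cosh_mul, coshDist_eq_cosh_mul, mul_lt_mul_iff_right₀ (Real.cosh_pos _),
      mem_ofPred_eq, inner_sub_right]
    constructor <;> intro h <;> linarith
  rw [← hmem, klein_ofKlein (norm_lineMap_klein_lt_one P Q ht)]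
  exact hconvex.lineMap_mem ((hmem P).2 (hP T hT hne)) ((hmem Q).2 (hQ T hT hne)) ht

end VoronoiCell

section Ellipse

variable {E : Type*} [NormedAddCommGroup E] [InnerProductSpace ℝ E] {P S T e : E} {ρ : ℝ}

/-- The point in direction `e` of the beach ellipse of `S` at sweep radius `ρ`. -/
def ellipsePoint (S : E) (ρ : ℝ) (e : E) : E := ofKlein ((ellipseCoth S ρ e)⁻¹ • e)

lemma norm_inv_ellipseCoth_smul (hS : ‖S‖ < ρ) (he : ‖e‖ = 1) :
    ‖(ellipseCoth S ρ e)⁻¹ • e‖ = (ellipseCoth S ρ e)⁻¹ := by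
  have := one_lt_ellipseCoth hS he
  rw [norm_smul, he, mul_one, Real.norm_of_nonneg (by positivity)]

lemma norm_inv_ellipseCoth_smul_lt_one (hS : ‖S‖ < ρ) (he : ‖e‖ = 1) :
    ‖(ellipseCoth S ρ e)⁻¹ • e‖ < 1 :=
  (norm_inv_ellipseCoth_smul hS he).trans_lt (inv_lt_one_of_one_lt₀ (one_lt_ellipseCoth hS he))

lemma normalize_ellipsePoint (hS : ‖S‖ < ρ) (he : ‖e‖ = 1) :
    dir (ellipsePoint S ρ e) = e := by
  have hpos : 0 < (ellipseCoth S ρ e)⁻¹ := inv_pos.2 (by linarith [one_lt_ellipseCoth hS he])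
  rw [ellipsePoint, normalize_ofKlein _ (norm_inv_ellipseCoth_smul_lt_one hS he),
    normalize_smul_of_pos hpos, normalize_eq_self_of_norm_eq_one he]
  rw [← norm_ne_zero_iff, norm_inv_ellipseCoth_smul hS he]
  exact hpos.ne'

lemma tanh_norm_ellipsePoint (hS : ‖S‖ < ρ) (he : ‖e‖ = 1) :
    Real.tanh ‖ellipsePoint S ρ e‖ = (ellipseCoth S ρ e)⁻¹ := by
  rw [← norm_klein, ellipsePoint, klein_ofKlein (norm_inv_ellipseCoth_smul_lt_one hS he),
    norm_inv_ellipseCoth_smul hS he]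

lemma continuousAt_ellipsePoint (hS : ‖S‖ < ρ) (he : ‖e‖ = 1) :
    ContinuousAt (ellipsePoint S ρ) e := by
  have hcoth : ContinuousAt (fun x => (ellipseCoth S ρ x)⁻¹ • x) e :=
    ((continuous_ellipseCoth S ρ).continuousAt.inv₀
      (by linarith [one_lt_ellipseCoth hS he])).smul continuousAt_id
  exact ContinuousAt.comp (f := fun x => (ellipseCoth S ρ x)⁻¹ • x)
    (continuousAt_ofKlein (norm_inv_ellipseCoth_smul_lt_one hS he)) hcoth

lemma coshDist_sub_cosh_eq (hT : ‖T‖ < ρ) (hP : P ≠ 0) :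
    coshDist P T - Real.cosh (ρ - ‖P‖) = Real.cosh ‖P‖ * (Real.cosh ρ - Real.cosh ‖T‖) *
      (Real.tanh ‖P‖ * ellipseCoth T ρ (dir P) - 1) := by
  rw [← cosh_mul_kleinGap_klein, klein, radial, kleinGap_smul hT (norm_normalize hP)
    (tanh_pos (norm_pos_iff.2 hP)).le, mul_assoc]

lemma coshDist_eq_cosh_iff (hS : ‖S‖ < ρ) (hP : P ≠ 0) :
    coshDist P S = Real.cosh (ρ - ‖P‖) ↔
      Real.tanh ‖P‖ * ellipseCoth S ρ (dir P) = 1 := by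
  have hS' := (cosh_sub_cosh_pos (norm_nonneg S) hS).ne'
  rw [← sub_eq_zero, coshDist_sub_cosh_eq hS hP, mul_eq_zero, sub_eq_zero (b := (1 : ℝ)),
    or_iff_right (mul_ne_zero (Real.cosh_pos _).ne' hS')]

lemma coshDist_lt_cosh_iff (hS : ‖S‖ < ρ) (hP : P ≠ 0) :
    coshDist P S < Real.cosh (ρ - ‖P‖) ↔
      Real.tanh ‖P‖ * ellipseCoth S ρ (dir P) < 1 := by
  have hS' := mul_pos (Real.cosh_pos ‖P‖) (cosh_sub_cosh_pos (norm_nonneg S) hS)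
  rw [← sub_neg, coshDist_sub_cosh_eq hS hP, mul_neg_iff, and_iff_right hS', sub_neg,
    or_iff_left fun h => hS'.not_gt h.1]

lemma ne_zero_of_coshDist_eq_cosh (hS : ‖S‖ < ρ)
    (hP : coshDist P S = Real.cosh (ρ - ‖P‖)) : P ≠ 0 := by
  rintro rfl
  have := cosh_sub_cosh_pos (norm_nonneg S) hS
  rw [coshDist, sinhVec, radial_zero, inner_zero_left, norm_zero, Real.cosh_zero] at hP
  simp only [sub_zero, one_mul] at hP
  linarith

lemma coshDist_ellipsePoint (hS : ‖S‖ < ρ) (he : ‖e‖ = 1) :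
    coshDist (ellipsePoint S ρ e) S = Real.cosh (ρ - ‖ellipsePoint S ρ e‖) := by
  have hcoth := one_lt_ellipseCoth hS he
  have hne : ellipsePoint S ρ e ≠ 0 := by
    rw [← (normalize_eq_zero_iff _).ne, normalize_ellipsePoint hS he, ← norm_ne_zero_iff, he]
    exact one_ne_zero
  rw [coshDist_eq_cosh_iff hS hne, normalize_ellipsePoint hS he, tanh_norm_ellipsePoint hS he,
    inv_mul_cancel₀ (by linarith)]

lemma ellipsePoint_normalize (hS : ‖S‖ < ρ) (hP : coshDist P S = Real.cosh (ρ - ‖P‖)) :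
    ellipsePoint S ρ (dir P) = P := by
  have hP₀ := ne_zero_of_coshDist_eq_cosh hS hP
  rw [ellipsePoint, inv_eq_of_mul_eq_one_left ((coshDist_eq_cosh_iff hS hP₀).1 hP)]
  exact ofKlein_klein P

lemma exists_coshDist_sub_eq_mul (hS : ‖S‖ < ρ) (hT : ‖T‖ < ρ)
    (hP : coshDist P S = Real.cosh (ρ - ‖P‖)) :
    ∃ c > 0, coshDist P T - coshDist P S =
      c * (ellipseCoth T ρ (dir P) - ellipseCoth S ρ (dir P)) := by
  have hP₀ := ne_zero_of_coshDist_eq_cosh hS hP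
  refine ⟨Real.cosh ‖P‖ * (Real.cosh ρ - Real.cosh ‖T‖) * Real.tanh ‖P‖,
    mul_pos (mul_pos (Real.cosh_pos _) (cosh_sub_cosh_pos (norm_nonneg T) hT))
      (tanh_pos (norm_pos_iff.2 hP₀)), ?_⟩
  rw [hP, coshDist_sub_cosh_eq hT hP₀, ← (coshDist_eq_cosh_iff hS hP₀).1 hP]
  ring

lemma coshDist_le_coshDist_iff (hS : ‖S‖ < ρ) (hT : ‖T‖ < ρ)
    (hP : coshDist P S = Real.cosh (ρ - ‖P‖)) :
    coshDist P S ≤ coshDist P T ↔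
      ellipseCoth S ρ (dir P) ≤ ellipseCoth T ρ (dir P) := by
  obtain ⟨c, hc, heq⟩ := exists_coshDist_sub_eq_mul hS hT hP
  rw [← sub_nonneg, heq, mul_nonneg_iff_of_pos_left hc, sub_nonneg]

lemma coshDist_eq_coshDist_iff (hS : ‖S‖ < ρ) (hT : ‖T‖ < ρ)
    (hP : coshDist P S = Real.cosh (ρ - ‖P‖)) :
    coshDist P S = coshDist P T ↔
      ellipseCoth S ρ (dir P) = ellipseCoth T ρ (dir P) := by
  obtain ⟨c, hc, heq⟩ := exists_coshDist_sub_eq_mul hS hT hP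
  rw [eq_comm, ← sub_eq_zero, heq, mul_eq_zero, or_iff_right hc.ne', sub_eq_zero, eq_comm]

end Ellipse

section BeachCurve

variable {A B P Q S T e : ℂ} {d ρ : ℝ}

lemma inner_eq_norm_mul_cos_arg_sub (A B : ℂ) :
    ⟪A, B⟫_ℝ = ‖A‖ * ‖B‖ * Real.cos (A.arg - B.arg) := by
  rw [Complex.inner, Complex.mul_re, Complex.conj_re, Complex.conj_im, Real.cos_sub,
    ← Complex.norm_mul_cos_arg A, ← Complex.norm_mul_cos_arg B, ← Complex.norm_mul_sin_arg A,
    ← Complex.norm_mul_sin_arg B]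
  ring

lemma arg_sinhVec (A : ℂ) : (sinhVec A).arg = A.arg := by
  rcases eq_or_ne A 0 with rfl | hA
  · simp [sinhVec]
  · have hA' := norm_pos_iff.2 hA
    rw [sinhVec, radial, NormedSpace.normalize, smul_smul, Complex.real_smul, Complex.arg_real_mul]
    have := Real.sinh_pos_iff.2 hA'
    positivity

lemma hypDist_eq_arcosh (A B : ℂ) : hypDist A B = Real.arcosh (coshDist A B) := by
  rw [hypDist, coshDist, inner_eq_norm_mul_cos_arg_sub, norm_sinhVec, norm_sinhVec, arg_sinhVec,
    arg_sinhVec]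

lemma cosh_hypDist (A B : ℂ) : Real.cosh (hypDist A B) = coshDist A B := by
  rw [hypDist_eq_arcosh, Real.cosh_arcosh (one_le_coshDist A B)]

lemma hypDist_nonneg (A B : ℂ) : 0 ≤ hypDist A B := by
  rw [hypDist_eq_arcosh]
  exact Real.arcosh_nonneg (one_le_coshDist A B)

lemma hypDist_eq_iff (hd : 0 ≤ d) : hypDist A B = d ↔ coshDist A B = Real.cosh d := by
  rw [← cosh_hypDist]
  exact (Real.cosh_injOn.eq_iff (hypDist_nonneg A B) hd).symm

lemma le_hypDist_iff (hd : 0 ≤ d) : d ≤ hypDist A B ↔ Real.cosh d ≤ coshDist A B := by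
  rw [← cosh_hypDist]
  exact (Real.cosh_strictMonoOn.le_iff_le hd (hypDist_nonneg A B)).symm

lemma mem_beachEllipse_iff :
    P ∈ beachEllipse S ρ ↔ ‖P‖ ≤ ρ ∧ coshDist P S = Real.cosh (ρ - ‖P‖) :=
  and_congr_right fun hP => hypDist_eq_iff (sub_nonneg.2 hP)

lemma abs_norm_sub_le_of_mem_beachEllipse (hP : P ∈ beachEllipse S ρ) :
    |‖P‖ - ‖S‖| ≤ ρ - ‖P‖ := by
  obtain ⟨hPρ, hPS⟩ := mem_beachEllipse_iff.1 hP
  have := Real.cosh_le_cosh.1 ((cosh_norm_sub_le_coshDist P S).trans_eq hPS)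
  rwa [abs_of_nonneg (sub_nonneg.2 hPρ)] at this

lemma norm_le_of_mem_beachEllipse (hP : P ∈ beachEllipse S ρ) : ‖S‖ ≤ ρ := by
  linarith [neg_le_of_abs_le (abs_norm_sub_le_of_mem_beachEllipse hP)]

lemma mem_beachEllipse_iff_of_norm_lt (hS : ‖S‖ < ρ) :
    P ∈ beachEllipse S ρ ↔ coshDist P S = Real.cosh (ρ - ‖P‖) := by
  rw [mem_beachEllipse_iff, and_iff_right_iff_imp]
  intro hPS
  by_contra! hPρ
  have := Real.cosh_le_cosh.1 ((cosh_norm_sub_le_coshDist P S).trans_eq hPS)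
  rw [abs_of_pos (by linarith), abs_of_neg (by linarith)] at this
  linarith

lemma ne_zero_of_mem_beachEllipse (hS : ‖S‖ < ρ) (hP : P ∈ beachEllipse S ρ) : P ≠ 0 :=
  ne_zero_of_coshDist_eq_cosh hS ((mem_beachEllipse_iff_of_norm_lt hS).1 hP)

lemma norm_lt_of_mem_beachEllipse (hS : ‖S‖ < ρ) (hP : P ∈ beachEllipse S ρ) : ‖P‖ < ρ := by
  linarith [le_of_abs_le (abs_norm_sub_le_of_mem_beachEllipse hP)]

lemma mem_beachEllipse_self_iff : P ∈ beachEllipse S ‖S‖ ↔ ‖P‖ ≤ ‖S‖ ∧ SameRay ℝ P S := by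
  rw [mem_beachEllipse_iff, ← coshDist_eq_cosh_norm_sub_iff, ← neg_sub ‖P‖, Real.cosh_neg]

lemma ellipsePoint_mem_beachEllipse (hS : ‖S‖ < ρ) (he : ‖e‖ = 1) :
    ellipsePoint S ρ e ∈ beachEllipse S ρ :=
  (mem_beachEllipse_iff_of_norm_lt hS).2 (coshDist_ellipsePoint hS he)

lemma ellipsePoint_normalize_of_mem (hS : ‖S‖ < ρ) (hP : P ∈ beachEllipse S ρ) :
    ellipsePoint S ρ (dir P) = P :=
  ellipsePoint_normalize hS ((mem_beachEllipse_iff_of_norm_lt hS).1 hP)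

lemma normalize_eq_iff_arg_eq (hP : P ≠ 0) (hQ : Q ≠ 0) :
    dir P = dir Q ↔ P.arg = Q.arg := by
  rw [← sameRay_iff_normalize_eq hP hQ, Complex.sameRay_iff, or_iff_right hP, or_iff_right hQ]

lemma exists_farther_mem_beachEllipse_iff (hP : P ≠ 0) (hT : ‖T‖ < ρ) :
    (∃ Q ∈ beachEllipse T ρ, P.arg = Q.arg ∧ ‖P‖ < ‖Q‖) ↔
      coshDist P T < Real.cosh (ρ - ‖P‖) := by
  have he : ‖dir P‖ = 1 := norm_normalize hP
  have hcoth : 0 < ellipseCoth T ρ (dir P) := one_pos.trans (one_lt_ellipseCoth hT he)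
  rw [coshDist_lt_cosh_iff hT hP, ← lt_div_iff₀ hcoth, one_div, ← tanh_norm_ellipsePoint hT he,
    tanh_strictMono.lt_iff_lt]
  constructor
  · rintro ⟨Q, hQ, harg, hPQ⟩
    have hQ₀ := ne_zero_of_mem_beachEllipse hT hQ
    rwa [(normalize_eq_iff_arg_eq hP hQ₀).2 harg, ellipsePoint_normalize_of_mem hT hQ]
  · intro h
    refine ⟨_, ellipsePoint_mem_beachEllipse hT he, ?_, h⟩
    rw [← normalize_eq_iff_arg_eq hP, normalize_ellipsePoint hT he]
    exact norm_pos_iff.1 ((norm_nonneg P).trans_lt h)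

lemma exists_farther_mem_beachEllipse_self_iff (hP : P ≠ 0) (hPT : ‖P‖ < ‖T‖) :
    (∃ Q ∈ beachEllipse T ‖T‖, P.arg = Q.arg ∧ ‖P‖ < ‖Q‖) ↔ SameRay ℝ P T := by
  have hT : T ≠ 0 := norm_pos_iff.1 ((norm_nonneg P).trans_lt hPT)
  constructor
  · rintro ⟨Q, hQ, harg, hPQ⟩
    have hQ₀ : Q ≠ 0 := norm_pos_iff.1 ((norm_nonneg P).trans_lt hPQ)
    rw [sameRay_iff_normalize_eq hP hT, (normalize_eq_iff_arg_eq hP hQ₀).2 harg,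
      ← sameRay_iff_normalize_eq hQ₀ hT]
    exact (mem_beachEllipse_self_iff.1 hQ).2
  · intro h
    refine ⟨T, mem_beachEllipse_self_iff.2 ⟨le_rfl, .rfl⟩, ?_, hPT⟩
    rwa [← normalize_eq_iff_arg_eq hP hT, ← sameRay_iff_normalize_eq hP hT]

end BeachCurve

section ActivePart

variable {𝒮 : Finset ℂ} {P S T e : ℂ} {ρ : ℝ}

lemma not_exists_farther_iff (hS : ‖S‖ < ρ) (hP : P ∈ beachEllipse S ρ) (T : ℂ) :
    (‖T‖ ≤ ρ → ¬ ∃ Q ∈ beachEllipse T ρ, P.arg = Q.arg ∧ ‖P‖ < ‖Q‖) ↔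
      coshDist P S ≤ coshDist P T ∧ (ρ ≤ ‖T‖ → coshDist P S < coshDist P T) := by
  have hP₀ := ne_zero_of_mem_beachEllipse hS hP
  have hPρ := norm_lt_of_mem_beachEllipse hS hP
  rw [(mem_beachEllipse_iff_of_norm_lt hS).1 hP]
  have hdist := cosh_norm_sub_le_coshDist P T
  rcases lt_trichotomy ‖T‖ ρ with hT | rfl | hT
  · rw [exists_farther_mem_beachEllipse_iff hP₀ hT, not_lt]
    exact ⟨fun h => ⟨h hT.le, fun h' => absurd hT h'.not_gt⟩, fun h _ => h.1⟩
  · rw [← neg_sub ‖P‖, Real.cosh_neg, exists_farther_mem_beachEllipse_self_iff hP₀ hPρ,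
      ← coshDist_eq_cosh_norm_sub_iff]
    exact ⟨fun h => ⟨hdist, fun h' => hdist.lt_of_ne' (h h')⟩, fun h h' => (h.2 h').ne'⟩
  · have hlt : Real.cosh (ρ - ‖P‖) < coshDist P T := by
      refine lt_of_lt_of_le (Real.cosh_lt_cosh.2 ?_) hdist
      rw [abs_of_pos (sub_pos.2 hPρ), abs_of_neg (by linarith)]
      linarith
    exact ⟨fun _ => ⟨hlt.le, fun _ => hlt⟩, fun _ h => absurd hT h.not_gt⟩

lemma mem_activePart_iff (hS : ‖S‖ < ρ) :
    P ∈ activePart 𝒮 S ρ ↔ P ∈ beachEllipse S ρ ∧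
      ∀ T ∈ 𝒮, coshDist P S ≤ coshDist P T ∧ (ρ ≤ ‖T‖ → coshDist P S < coshDist P T) := by
  refine and_congr_right fun hP => ?_
  simp only [← not_exists_farther_iff hS hP]
  exact ⟨fun h T hT hTρ hQ => h ⟨T, ⟨hT, hTρ⟩, hQ⟩, fun h ⟨T, ⟨hT, hTρ⟩, hQ⟩ => h T hT hTρ hQ⟩

lemma StrictlyClosest.mem_activePart (h : StrictlyClosest 𝒮 S P) (hS : ‖S‖ < ρ)
    (hP : P ∈ beachEllipse S ρ) : P ∈ activePart 𝒮 S ρ := by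
  refine (mem_activePart_iff hS).2 ⟨hP, fun T hT => ?_⟩
  rcases eq_or_ne T S with rfl | hne
  · exact ⟨le_rfl, fun h => absurd hS h.not_gt⟩
  · exact ⟨(h T hT hne).le, fun _ => h T hT hne⟩

lemma exists_affineMap_complex_apply (g : ℂ →ᵃ[ℝ] ℝ) :
    ∃ a b c : ℝ, ∀ z, g z = z.re * a + z.im * b + c := by
  refine ⟨g.linear 1, g.linear Complex.I, g 0, fun z => ?_⟩
  have hz : g.linear z = g.linear (z.re • 1 + z.im • Complex.I) := by simp
  rw [map_add, map_smul, map_smul, smul_eq_mul, smul_eq_mul] at hz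
  rw [← hz, g.decomp']
  simp

lemma finite_setOf_norm_eq_one_eq_zero {g : ℂ →ᵃ[ℝ] ℝ} (hg : g ≠ 0) :
    {e : ℂ | ‖e‖ = 1 ∧ g e = 0}.Finite := by
  obtain ⟨a, b, c, happly⟩ := exists_affineMap_complex_apply g
  simp only [happly]
  rcases eq_or_ne (a ^ 2 + b ^ 2) 0 with hab | hab
  · have ha : a = 0 := by nlinarith [sq_nonneg a, sq_nonneg b]
    have hb : b = 0 := by nlinarith [sq_nonneg a, sq_nonneg b]
    simp only [ha, hb, mul_zero, add_zero, zero_add] at happly ⊢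
    refine finite_empty.subset fun e ⟨_, hc⟩ => hg (AffineMap.ext fun z => ?_)
    rw [happly, hc, AffineMap.coe_zero, Pi.zero_apply]
  · have hsq {e : ℂ} (he : ‖e‖ = 1) : e.re ^ 2 + e.im ^ 2 = 1 := by
      rw [← one_pow 2, ← he, Complex.sq_norm, Complex.normSq_apply]
      ring
    have hfin : {s : ℝ | s ^ 2 = a ^ 2 + b ^ 2 - c ^ 2}.Finite :=
      (toFinite {√(a ^ 2 + b ^ 2 - c ^ 2), -√(a ^ 2 + b ^ 2 - c ^ 2)}).subset fun s hs => by
        rw [← show s ^ 2 = _ from hs, Real.sqrt_sq_eq_abs]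
        exact (abs_choice s).imp (·.symm) fun h => by simp [h]
    -- `(e.re * a + e.im * b) ^ 2 + (e.im * a - e.re * b) ^ 2 = a ^ 2 + b ^ 2` on the unit circle
    refine Finite.of_injOn (f := fun e => e.im * a - e.re * b) ?_ ?_ hfin
    · rintro e ⟨he, hge⟩
      change (e.im * a - e.re * b) ^ 2 = a ^ 2 + b ^ 2 - c ^ 2
      linear_combination (a ^ 2 + b ^ 2) * hsq he - (e.re * a + e.im * b - c) * hge
    · rintro e ⟨-, he⟩ f ⟨-, hf⟩ heq
      simp only at heq
      have hre : (a ^ 2 + b ^ 2) * e.re = (a ^ 2 + b ^ 2) * f.re := by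
        linear_combination a * he - a * hf - b * heq
      have him : (a ^ 2 + b ^ 2) * e.im = (a ^ 2 + b ^ 2) * f.im := by
        linear_combination b * he - b * hf + a * heq
      exact Complex.ext (mul_left_cancel₀ hab hre) (mul_left_cancel₀ hab him)

lemma finite_beachEllipse_equidistant (hS : ‖S‖ < ρ) (hT : ‖T‖ < ρ) (hne : S ≠ T) :
    {P ∈ beachEllipse S ρ | coshDist P S = coshDist P T}.Finite := by
  have hg : ellipseCoth S ρ - ellipseCoth T ρ ≠ 0 := sub_ne_zero.2 fun h =>
    hne (ellipseCoth_injOn ρ (by simpa using hS) (by simpa using hT) h)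
  refine ((finite_setOf_norm_eq_one_eq_zero hg).image (ellipsePoint S ρ)).subset ?_
  rintro P ⟨hP, heq⟩
  refine ⟨dir P, ⟨norm_normalize (ne_zero_of_mem_beachEllipse hS hP), ?_⟩,
    ellipsePoint_normalize_of_mem hS hP⟩
  exact sub_eq_zero.2
    ((coshDist_eq_coshDist_iff hS hT ((mem_beachEllipse_iff_of_norm_lt hS).1 hP)).1 heq)

lemma exists_strictlyClosest {C : Set ℂ} (hS : ‖S‖ < ρ) (hC : IsPreconnected C)
    (hC' : C.Nontrivial) (hCS : C ⊆ activePart 𝒮 S ρ) : ∃ P ∈ C, StrictlyClosest 𝒮 S P := by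
  have hfin : (⋃ T ∈ {T | T ∈ 𝒮 ∧ T ≠ S ∧ ‖T‖ < ρ},
      {P ∈ beachEllipse S ρ | coshDist P S = coshDist P T}).Finite :=
    (𝒮.finite_toSet.subset fun T hT => hT.1).biUnion fun T hT =>
      finite_beachEllipse_equidistant hS hT.2.2 hT.2.1.symm
  obtain ⟨P, hP, hPfin⟩ := ((hC.infinite_of_nontrivial hC').sdiff hfin).nonempty
  refine ⟨P, hP, fun T hT hne => ?_⟩
  obtain ⟨hPS, hclosest⟩ := (mem_activePart_iff hS).1 (hCS hP)
  rcases lt_or_ge ‖T‖ ρ with hTρ | hTρ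
  · exact (hclosest T hT).1.lt_of_ne fun heq => hPfin (mem_biUnion ⟨hT, hne, hTρ⟩ ⟨hPS, heq⟩)
  · exact (hclosest T hT).2 hTρ

lemma exists_isPreconnected_unit_nhds (he : ‖e‖ = 1) {U : Set ℂ} (hU : U ∈ 𝓝 e) :
    ∃ N ⊆ U, (∀ x ∈ N, ‖x‖ = 1) ∧ IsPreconnected N ∧ N.Nontrivial ∧ e ∈ N := by
  let rot (θ : ℝ) : ℂ := Complex.exp (θ * Complex.I) * e
  have hrot : Continuous rot := by fun_prop
  have hrot₀ : rot 0 = e := by simp [rot]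
  obtain ⟨δ, hδ, hball⟩ := Metric.mem_nhds_iff.1 (hrot.continuousAt.preimage_mem_nhds
    (hrot₀.symm ▸ hU : U ∈ 𝓝 (rot 0)))
  have hη : 0 < min (δ / 2) 1 := by positivity
  refine ⟨rot '' Icc 0 (min (δ / 2) 1), ?_, ?_, isPreconnected_Icc.image _ hrot.continuousOn,
    ⟨_, mem_image_of_mem _ (left_mem_Icc.2 hη.le), _, mem_image_of_mem _ (right_mem_Icc.2 hη.le),
      ?_⟩, 0, left_mem_Icc.2 hη.le, hrot₀⟩
  · rintro _ ⟨θ, hθ, rfl⟩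
    refine hball ?_
    rw [mem_ball_zero_iff, Real.norm_of_nonneg hθ.1]
    linarith [hθ.2, min_le_left (δ / 2) 1]
  · rintro _ ⟨θ, -, rfl⟩
    rw [norm_mul, Complex.norm_exp_ofReal_mul_I, he, one_mul]
  · intro heq
    have he₀ : e ≠ 0 := norm_ne_zero_iff.1 (by rw [he]; exact one_ne_zero)
    have := congrArg Complex.im (mul_right_cancel₀ he₀ heq)
    rw [Complex.exp_ofReal_mul_I_im, Complex.exp_ofReal_mul_I_im, Real.sin_zero] at this
    exact (Real.sin_pos_of_pos_of_lt_pi hη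
      ((min_le_right _ _).trans_lt (by linarith [Real.pi_gt_three]))).ne this

lemma StrictlyClosest.exists_mem_activeSegments (h : StrictlyClosest 𝒮 S P) (hS : ‖S‖ < ρ)
    (hP : P ∈ beachEllipse S ρ) : ∃ C ∈ activeSegments 𝒮 S ρ, P ∈ C := by
  have he := norm_normalize (ne_zero_of_mem_beachEllipse hS hP)
  have hcont (x : ℂ) (hx : ‖x‖ = 1) := continuousAt_ellipsePoint hS hx
  obtain ⟨N, hNU, hN, hNconn, ⟨x, hx, y, hy, hxy⟩, heN⟩ :=
    exists_isPreconnected_unit_nhds he <| (hcont _ he).preimage_mem_nhds <|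
      (isOpen_setOf_strictlyClosest 𝒮 S).mem_nhds <|
        (ellipsePoint_normalize_of_mem hS hP).symm ▸ h
  have hPN : P ∈ ellipsePoint S ρ '' N := ⟨_, heN, ellipsePoint_normalize_of_mem hS hP⟩
  have hNactive : ellipsePoint S ρ '' N ⊆ activePart 𝒮 S ρ := by
    rintro _ ⟨z, hz, rfl⟩
    exact (hNU hz).mem_activePart hS (ellipsePoint_mem_beachEllipse hS (hN z hz))
  have hsub := (hNconn.image _ fun z hz => (hcont z (hN z hz)).continuousWithinAt)
    |>.subset_connectedComponentIn hPN hNactive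
  refine ⟨_, ⟨⟨_, hsub (mem_image_of_mem _ hx), _, hsub (mem_image_of_mem _ hy), fun heq => hxy ?_⟩,
    P, hNactive hPN, rfl⟩, hsub hPN⟩
  rw [← normalize_ellipsePoint hS (hN x hx), heq, normalize_ellipsePoint hS (hN y hy)]

end ActivePart

section Continuation

lemma exists_sign_change_of_convexOn {g : ℝ → ℝ} (hg : ConvexOn ℝ univ g) (hcont : Continuous g)
    (h₀ : 0 ≤ g 0) (h₁ : g 1 < 0) :
    ∃ τ ∈ Ico (0 : ℝ) 1, g τ = 0 ∧ (∀ t < τ, 0 < g t) ∧ ∀ t, τ < t → t < 1 → g t < 0 := by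
  obtain ⟨τ, hτ, hgτ⟩ := intermediate_value_Icc' zero_le_one hcont.continuousOn ⟨h₁.le, h₀⟩
  have hτ₁ : τ < 1 := hτ.2.lt_of_ne fun h => h₁.ne (h ▸ hgτ)
  refine ⟨τ, ⟨hτ.1, hτ₁⟩, hgτ, fun t ht => ?_, fun t ht ht₁ => ?_⟩
  · rw [← hgτ]
    refine hg.lt_left_of_right_lt (mem_univ t) (mem_univ 1) ?_ (h₁.trans_eq hgτ.symm)
    rw [openSegment_eq_Ioo (ht.trans hτ₁)]
    exact ⟨ht, hτ₁⟩
  · by_contra! hgt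
    refine (hg.lt_left_of_right_lt (mem_univ τ) (mem_univ 1) ?_ (h₁.trans_le hgt)).not_ge
      (hgτ.trans_le hgt)
    rw [openSegment_eq_Ioo hτ₁]
    exact ⟨ht, ht₁⟩

lemma continuousOn_of_sign_change {X : Type*} [TopologicalSpace X] {s : Set X} {G : X → ℝ → ℝ}
    {τ : X → ℝ} {c : ℝ} (hG : ∀ t, ContinuousOn (fun x => G x t) s) (hτ : ∀ x ∈ s, τ x < c)
    (hpos : ∀ x ∈ s, ∀ t < τ x, 0 < G x t) (hneg : ∀ x ∈ s, ∀ t, τ x < t → t < c → G x t < 0) :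
    ContinuousOn τ s := by
  intro x hx
  refine tendsto_order.2 ⟨fun a ha => ?_, fun b hb => ?_⟩
  · obtain ⟨t, hat, htτ⟩ := exists_between ha
    filter_upwards [(hG t x hx).eventually (lt_mem_nhds (hpos x hx t htτ)), self_mem_nhdsWithin]
      with y hGy hy
    by_contra! hya
    exact hGy.not_gt (hneg y hy t (hya.trans_lt hat) (htτ.trans (hτ x hx)))
  · obtain ⟨t, hτt, ht⟩ := exists_between (lt_min hb (hτ x hx))
    filter_upwards [(hG t x hx).eventually
      (gt_mem_nhds (hneg x hx t hτt (ht.trans_le (min_le_right b c)))), self_mem_nhdsWithin]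
      with y hGy hy
    by_contra! hyb
    exact hGy.not_gt (hpos y hy t ((ht.trans_le (min_le_left b c)).trans_le hyb))

lemma exists_continuousOn_root_of_convexOn {X : Type*} [TopologicalSpace X] {s : Set X}
    {G : X → ℝ → ℝ} (hconvex : ∀ x ∈ s, ConvexOn ℝ univ (G x)) (hcont : ∀ x ∈ s, Continuous (G x))
    (hG : ∀ t, ContinuousOn (fun x => G x t) s) (h₀ : ∀ x ∈ s, 0 ≤ G x 0)
    (h₁ : ∀ x ∈ s, G x 1 < 0) :
    ∃ τ : X → ℝ, ContinuousOn τ s ∧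
      ∀ x ∈ s, τ x ∈ Icc (0 : ℝ) 1 ∧ G x (τ x) = 0 ∧ (G x 0 = 0 → τ x = 0) := by
  have hroot (x) (hx : x ∈ s) :=
    exists_sign_change_of_convexOn (hconvex x hx) (hcont x hx) (h₀ x hx) (h₁ x hx)
  choose! τ hτ hroot hpos hneg using hroot
  refine ⟨τ, continuousOn_of_sign_change hG (fun x hx => (hτ x hx).2) hpos hneg,
    fun x hx => ⟨Ico_subset_Icc_self (hτ x hx), hroot x hx, fun h => ?_⟩⟩
  exact ((hτ x hx).1.eq_of_not_lt fun hlt => (hpos x hx 0 hlt).ne' h).symm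

variable {𝒮 : Finset ℂ} {P S : ℂ} {ρ r₁ r₂ : ℝ} {C : Set ℂ}

lemma mem_beachEllipse_iff_kleinGap (hS : ‖S‖ < ρ) :
    P ∈ beachEllipse S ρ ↔ kleinGap S ρ (klein P) = 0 := by
  rw [mem_beachEllipse_iff_of_norm_lt hS, ← sub_eq_zero, ← cosh_mul_kleinGap_klein,
    mul_eq_zero, or_iff_right (Real.cosh_pos _).ne']

lemma kleinGap_klein_self_neg (hS : ‖S‖ < ρ) : kleinGap S ρ (klein S) < 0 := by
  refine neg_of_mul_neg_right ?_ (Real.cosh_pos ‖S‖).le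
  rw [cosh_mul_kleinGap_klein, coshDist_self, sub_neg, Real.one_lt_cosh]
  exact (sub_pos.2 hS).ne'

lemma kleinGap_klein_nonneg_of_mem_beachEllipse (hS : ‖S‖ ≤ ρ) (hρ : ρ ≤ r₂)
    (hP : P ∈ beachEllipse S r₂) : 0 ≤ kleinGap S ρ (klein P) := by
  refine nonneg_of_mul_nonneg_right ?_ (Real.cosh_pos ‖P‖)
  have habs := abs_norm_sub_le_of_mem_beachEllipse hP
  rw [cosh_mul_kleinGap_klein, (mem_beachEllipse_iff.1 hP).2, sub_nonneg, Real.cosh_le_cosh]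
  refine (abs_le.2 ⟨?_, ?_⟩).trans (le_abs_self _) <;> linarith [abs_le.1 habs]

/-- While the ellipse shrinks, `P` is pushed along the geodesic towards `S`. -/
lemma StrictlyClosest.exists_path (h : StrictlyClosest 𝒮 S P) (hS : ‖S‖ < r₁) (hr : r₁ ≤ r₂)
    (hP : P ∈ beachEllipse S r₂) :
    ∃ γ : ℝ → ℂ, ContinuousOn γ (Icc r₁ r₂) ∧ γ r₂ = P ∧
      ∀ ρ ∈ Icc r₁ r₂, γ ρ ∈ beachEllipse S ρ ∧ StrictlyClosest 𝒮 S (γ ρ) := by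
  let z : ℝ → ℂ := AffineMap.lineMap (klein P) (klein S)
  have hz : Continuous z := AffineMap.lineMap_continuous
  obtain ⟨τ, hτ, hroot⟩ := exists_continuousOn_root_of_convexOn (s := Icc r₁ r₂)
    (G := fun ρ t => kleinGap S ρ (z t))
    (fun ρ hρ => (convexOn_kleinGap S ((norm_nonneg S).trans (hS.le.trans hρ.1))).comp_affineMap
      (AffineMap.lineMap (klein P) (klein S)))
    (fun ρ _ => (continuous_kleinGap S).comp (continuous_const.prodMk hz))
    (fun t => ((continuous_kleinGap S).comp (continuous_id.prodMk continuous_const)).continuousOn)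
    (fun ρ hρ => by
      simpa [z] using kleinGap_klein_nonneg_of_mem_beachEllipse (hS.le.trans hρ.1) hρ.2 hP)
    (fun ρ hρ => by simpa [z] using kleinGap_klein_self_neg (hS.trans_le hρ.1))
  have hnorm (ρ : ℝ) (hρ : ρ ∈ Icc r₁ r₂) : ‖z (τ ρ)‖ < 1 :=
    norm_lineMap_klein_lt_one P S (hroot ρ hρ).1
  refine ⟨fun ρ => ofKlein (z (τ ρ)), fun ρ hρ => ?_, ?_, fun ρ hρ => ⟨?_, ?_⟩⟩
  · exact (continuousAt_ofKlein (hnorm ρ hρ)).comp_continuousWithinAt (f := fun ρ => z (τ ρ))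
      (hz.continuousAt.comp_continuousWithinAt (hτ ρ hρ))
  · have hτ₀ : τ r₂ = 0 := (hroot r₂ (right_mem_Icc.2 hr)).2.2 (by
      simpa [z] using (mem_beachEllipse_iff_kleinGap (hS.trans_le hr)).1 hP)
    simp only [hτ₀, z, AffineMap.lineMap_apply_zero, ofKlein_klein]
  · rw [mem_beachEllipse_iff_kleinGap (hS.trans_le hρ.1), klein_ofKlein (hnorm ρ hρ)]
    exact (hroot ρ hρ).2.1
  · exact h.ofKlein_lineMap (strictlyClosest_self 𝒮 S) (hroot ρ hρ).1

lemma subset_activePart_of_mem_activeSegments (hC : C ∈ activeSegments 𝒮 S ρ) :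
    C ⊆ activePart 𝒮 S ρ := by
  obtain ⟨-, P, -, rfl⟩ := hC
  exact connectedComponentIn_subset _ _

lemma isPreconnected_of_mem_activeSegments (hC : C ∈ activeSegments 𝒮 S ρ) :
    IsPreconnected C := by
  obtain ⟨-, P, -, rfl⟩ := hC
  exact isPreconnected_connectedComponentIn

lemma exists_continues (hS : ‖S‖ < r₁) (hr : r₁ ≤ r₂) (hC : C ∈ activeSegments 𝒮 S r₂) :
    ∃ C' ∈ activeSegments 𝒮 S r₁, Continues 𝒮 S r₁ C' r₂ C := by
  have hCactive := subset_activePart_of_mem_activeSegments hC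
  obtain ⟨P, hP, hclosest⟩ := exists_strictlyClosest (hS.trans_le hr)
    (isPreconnected_of_mem_activeSegments hC) hC.1 hCactive
  obtain ⟨γ, hγ, rfl, hγS⟩ := hclosest.exists_path hS hr (hCactive hP).1
  have hsegment (ρ : ℝ) (hρ : ρ ∈ Icc r₁ r₂) : ∃ D ∈ activeSegments 𝒮 S ρ, γ ρ ∈ D :=
    (hγS ρ hρ).2.exists_mem_activeSegments (hS.trans_le hρ.1) (hγS ρ hρ).1
  obtain ⟨C', hC', hγC'⟩ := hsegment r₁ (left_mem_Icc.2 hr)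
  exact ⟨C', hC', γ, hγ, hsegment, hγC', hP⟩

end Continuation

section CircleArc

variable {w x e f : ℂ} {M : Set ℂ} {ι : Type*}

/-- The stereographic coordinate of a point `x ≠ w` of the unit circle, with center of projection
`w`. -/
def stereo (w x : ℂ) : ℝ := ((w + x) / (w - x)).im

/-- The inverse of the stereographic coordinate with center of projection `w`. -/
def stereoInv (w : ℂ) (t : ℝ) : ℂ := w * ((t * Complex.I - 1) / (t * Complex.I + 1))

/-- The arc of the unit circle with endpoints `e` and `f` that does not contain `w`. -/
def arcAvoiding (w e f : ℂ) : Set ℂ := stereoInv w '' uIcc (stereo w e) (stereo w f)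

lemma mul_I_add_one_ne_zero (t : ℝ) : (t * Complex.I + 1 : ℂ) ≠ 0 := fun h => by
  simpa using congrArg Complex.re h

lemma stereoInv_eq (w : ℂ) (t : ℝ) :
    stereoInv w t = w * ⟨(t ^ 2 - 1) / (1 + t ^ 2), 2 * t / (1 + t ^ 2)⟩ := by
  have hpos : (1 + t ^ 2 : ℂ) ≠ 0 := by exact_mod_cast (by positivity : 1 + t ^ 2 ≠ 0)
  rw [stereoInv, Complex.mk_eq_add_mul_I]
  congr 1
  rw [div_eq_iff (mul_I_add_one_ne_zero t)]
  push_cast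
  field_simp
  linear_combination -2 * (t : ℂ) ^ 2 * Complex.I_sq

lemma continuous_stereoInv (w : ℂ) : Continuous (stereoInv w) :=
  continuous_const.mul ((by fun_prop : Continuous fun t : ℝ => (t * Complex.I - 1 : ℂ)).div₀
    (by fun_prop) mul_I_add_one_ne_zero)

lemma continuousAt_stereo (hx : x ≠ w) : ContinuousAt (stereo w) x := by
  unfold stereo
  fun_prop (disch := exact sub_ne_zero.2 hx.symm)

lemma stereo_mul_I (hnorm : ‖x‖ = ‖w‖) : stereo w x * Complex.I = (w + x) / (w - x) := by
  have hsq : x.re * x.re + x.im * x.im = w.re * w.re + w.im * w.im := by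
    rw [← Complex.normSq_apply, ← Complex.normSq_apply, ← Complex.sq_norm, hnorm, Complex.sq_norm]
  have hre : ((w + x) / (w - x)).re = 0 := by
    rw [Complex.div_re, ← add_div, div_eq_zero_iff]
    left
    simp only [Complex.add_re, Complex.add_im, Complex.sub_re, Complex.sub_im]
    linear_combination -hsq
  rw [← Complex.re_add_im ((w + x) / (w - x)), hre, Complex.ofReal_zero, zero_add, stereo]

lemma stereoInv_stereo (hnorm : ‖x‖ = ‖w‖) (hne : x ≠ w) : stereoInv w (stereo w x) = x := by
  have hsub : w - x ≠ 0 := sub_ne_zero.2 hne.symm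
  have hw : w ≠ 0 := by
    rintro rfl
    exact hne (norm_eq_zero.1 (hnorm.trans norm_zero))
  rw [stereoInv, stereo_mul_I hnorm, div_sub_one hsub, div_add_one hsub,
    div_div_div_cancel_right₀ hsub, add_add_sub_cancel, ← two_mul,
    show w + x - (w - x) = 2 * x by ring, mul_div_mul_left _ _ two_ne_zero, mul_div_cancel₀ _ hw]

lemma left_mem_arcAvoiding (hnorm : ‖e‖ = ‖w‖) (hne : e ≠ w) (f : ℂ) : e ∈ arcAvoiding w e f :=
  ⟨_, left_mem_uIcc, stereoInv_stereo hnorm hne⟩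

lemma right_mem_arcAvoiding (hnorm : ‖f‖ = ‖w‖) (hne : f ≠ w) (e : ℂ) : f ∈ arcAvoiding w e f :=
  ⟨_, right_mem_uIcc, stereoInv_stereo hnorm hne⟩

lemma isPreconnected_arcAvoiding (w e f : ℂ) : IsPreconnected (arcAvoiding w e f) :=
  isPreconnected_uIcc.image _ (continuous_stereoInv w).continuousOn

lemma arcAvoiding_subset (hM : IsPreconnected M) (hnorm : ∀ x ∈ M, ‖x‖ = ‖w‖) (hw : w ∉ M)
    (he : e ∈ M) (hf : f ∈ M) : arcAvoiding w e f ⊆ M := by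
  have hne {x : ℂ} (hx : x ∈ M) : x ≠ w := fun h => hw (h ▸ hx)
  have hconn : (stereo w '' M).OrdConnected := (hM.image _ fun x hx =>
    (continuousAt_stereo (hne hx)).continuousWithinAt).ordConnected
  rintro _ ⟨t, ht, rfl⟩
  obtain ⟨x, hx, rfl⟩ := hconn.uIcc_subset (mem_image_of_mem _ he) (mem_image_of_mem _ hf) ht
  rwa [stereoInv_stereo (hnorm x hx) (hne hx)]

/-- In the stereographic coordinate, an affine function that is negative at `w` becomes, up
to a positive factor, a strictly concave quadratic. -/
lemma convex_setOf_nonneg_stereoInv {g : ℂ →ᵃ[ℝ] ℝ} (hw : g w < 0) :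
    Convex ℝ {t : ℝ | 0 ≤ g (stereoInv w t)} := by
  obtain ⟨a, b, c, happly⟩ :=
    exists_affineMap_complex_apply (g.comp (LinearMap.mulLeft ℝ w).toAffineMap)
  have hac : a + c < 0 := by simpa using (happly 1).symm.trans_lt (by simpa using hw)
  have hquad (t : ℝ) :
      (1 + t ^ 2) * g (stereoInv w t) = (a + c) * t ^ 2 + 2 * b * t + (c - a) := by
    have hg : g (stereoInv w t) = (t ^ 2 - 1) / (1 + t ^ 2) * a + 2 * t / (1 + t ^ 2) * b + c := by
      rw [stereoInv_eq]
      exact happly _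
    rw [hg]
    field_simp
    ring
  have hiff (t : ℝ) : 0 ≤ g (stereoInv w t) ↔ 0 ≤ (a + c) * t ^ 2 + 2 * b * t + (c - a) := by
    rw [← hquad, mul_nonneg_iff_of_pos_left (by positivity)]
  simp only [hiff]
  intro t ht u hu α β hα hβ hαβ
  simp only [mem_ofPred_eq, smul_eq_mul] at ht hu ⊢
  obtain rfl : β = 1 - α := by linarith
  nlinarith [mul_nonneg hα ht, mul_nonneg hβ hu,
    mul_nonneg (mul_nonneg hα hβ) (mul_nonneg (neg_nonneg.2 hac.le) (sq_nonneg (t - u)))]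

lemma nonneg_of_mem_arcAvoiding {g : ℂ →ᵃ[ℝ] ℝ} (hw : g w < 0) (hwe : ‖e‖ = ‖w‖)
    (hwf : ‖f‖ = ‖w‖) (he : 0 ≤ g e) (hf : 0 ≤ g f) (hx : x ∈ arcAvoiding w e f) : 0 ≤ g x := by
  have hmem {y : ℂ} (hy : ‖y‖ = ‖w‖) (hgy : 0 ≤ g y) :
      stereo w y ∈ {t : ℝ | 0 ≤ g (stereoInv w t)} := by
    rw [mem_ofPred_eq, stereoInv_stereo hy fun h => (h ▸ hgy).not_gt hw]
    exact hgy
  obtain ⟨t, ht, rfl⟩ := hx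
  exact (convex_setOf_nonneg_stereoInv hw).ordConnected.uIcc_subset (hmem hwe he) (hmem hwf hf) ht

/-- The arc cut out of `M` by `e` and `f` is the same for every center of projection outside `M`,
so it lies in all the half-planes at once. -/
lemma exists_isPreconnected_unit_subset {g : ι → ℂ →ᵃ[ℝ] ℝ} {w : ι → ℂ} (hM : IsPreconnected M)
    (hnorm : ∀ x ∈ M, ‖x‖ = 1) (he : e ∈ M) (hf : f ∈ M) (hwM : ∀ i, w i ∉ M)
    (hw : ∀ i, ‖w i‖ = 1) (hgw : ∀ i, g i (w i) < 0) (hge : ∀ i, 0 ≤ g i e)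
    (hgf : ∀ i, 0 ≤ g i f) :
    ∃ N, IsPreconnected N ∧ e ∈ N ∧ f ∈ N ∧ ∀ x ∈ N, ‖x‖ = 1 ∧ ∀ i, 0 ≤ g i x := by
  have hnorm' (i : ι) (x : ℂ) (hx : x ∈ M) : ‖x‖ = ‖w i‖ := (hnorm x hx).trans (hw i).symm
  have hne (i : ι) {x : ℂ} (hx : x ∈ M) : x ≠ w i := fun h => hwM i (h ▸ hx)
  have hsub (i : ι) : arcAvoiding (w i) e f ⊆ M :=
    arcAvoiding_subset hM (hnorm' i) (hwM i) he hf
  rcases isEmpty_or_nonempty ι with hι | ⟨⟨j⟩⟩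
  · have hrank : 1 < Module.rank ℝ ℂ := by
      rw [Complex.rank_real_complex]
      exact Cardinal.one_lt_two
    exact ⟨Metric.sphere 0 1, isPreconnected_sphere hrank 0 1, by simpa using hnorm e he,
      by simpa using hnorm f hf, fun x hx => ⟨by simpa using hx, fun i => hι.elim i⟩⟩
  · refine ⟨arcAvoiding (w j) e f, isPreconnected_arcAvoiding _ _ _,
      left_mem_arcAvoiding (hnorm' j e he) (hne j he) f,
      right_mem_arcAvoiding (hnorm' j f hf) (hne j hf) e,
      fun x hx => ⟨hnorm x (hsub j hx), fun i => ?_⟩⟩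
    refine nonneg_of_mem_arcAvoiding (hgw i) (hnorm' i e he) (hnorm' i f hf) (hge i) (hgf i) ?_
    exact arcAvoiding_subset (isPreconnected_arcAvoiding _ _ _)
      (fun y hy => hnorm' j y (hsub i hy)) (fun h => hwM j (hsub i h))
      (left_mem_arcAvoiding (hnorm' i e he) (hne i he) f)
      (right_mem_arcAvoiding (hnorm' i f hf) (hne i hf) e) hx

end CircleArc

section Barrier

variable {𝒮 : Finset ℂ} {P Q S T : ℂ} {ρ r₁ r₂ : ℝ} {C C' D K : Set ℂ}

/-- A direction in which the beach ellipse of `T` lies strictly outside that of `S`, for every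
sweep radius beyond both sites. As it does not depend on the sweep radius, active segments of `S`
cannot move past it. -/
def barrier {E : Type*} [NormedAddCommGroup E] [NormedSpace ℝ E] (S T : E) : E :=
  if ‖S‖ < ‖T‖ then dir T else -dir S

lemma norm_barrier {E : Type*} [NormedAddCommGroup E] [NormedSpace ℝ E] {S T : E} (hne : T ≠ S) :
    ‖barrier S T‖ = 1 := by
  rw [barrier]
  split_ifs with hST
  · exact norm_normalize (norm_pos_iff.1 ((norm_nonneg S).trans_lt hST))
  · rw [norm_neg]
    refine norm_normalize fun hS => hne ?_
    rw [hS, norm_zero, norm_pos_iff, not_not] at hST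
    rw [hST, hS]

lemma coshDist_lt_coshDist_of_normalize_eq_barrier (hS : ‖S‖ < ρ) (hT : ‖T‖ < ρ) (hne : T ≠ S)
    (hP : P ∈ beachEllipse S ρ) (hdir : dir P = barrier S T) : coshDist P T < coshDist P S := by
  have hP₀ := ne_zero_of_mem_beachEllipse hS hP
  rw [barrier] at hdir
  split_ifs at hdir with hST
  · have hT₀ : T ≠ 0 := norm_pos_iff.1 ((norm_nonneg S).trans_lt hST)
    rw [coshDist_eq_cosh_norm_sub_iff.2 ((sameRay_iff_normalize_eq hP₀ hT₀).2 hdir),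
      (mem_beachEllipse_iff.1 hP).2, Real.cosh_lt_cosh]
    refine lt_of_lt_of_le (abs_lt.2 ⟨?_, ?_⟩) (le_abs_self _)
    · linarith
    · linarith [le_of_abs_le (abs_norm_sub_le_of_mem_beachEllipse hP)]
  · have hS₀ : S ≠ 0 := by
      rintro rfl
      rw [norm_zero, norm_pos_iff, not_not] at hST
      exact hne hST
    refine coshDist_lt_coshDist_of_sameRay_neg hP₀ ?_ (not_lt.1 hST) hne
    rw [sameRay_iff_normalize_eq hP₀ (neg_ne_zero.2 hS₀), hdir, normalize_neg]

lemma ellipseCoth_barrier_lt (hS : ‖S‖ < ρ) (hT : ‖T‖ < ρ) (hne : T ≠ S) :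
    ellipseCoth T ρ (barrier S T) < ellipseCoth S ρ (barrier S T) := by
  have hP := ellipsePoint_mem_beachEllipse hS (norm_barrier hne)
  have hdir := normalize_ellipsePoint hS (norm_barrier hne)
  have hlt := coshDist_lt_coshDist_of_normalize_eq_barrier hS hT hne hP hdir
  rwa [← not_le, coshDist_le_coshDist_iff hS hT ((mem_beachEllipse_iff_of_norm_lt hS).1 hP),
    hdir, not_le] at hlt

lemma normalize_ne_barrier (hS : ‖S‖ < ρ) (hT : ‖T‖ < ρ) (hT𝒮 : T ∈ 𝒮) (hne : T ≠ S)
    (hP : P ∈ activePart 𝒮 S ρ) : dir P ≠ barrier S T := fun h =>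
  (((mem_activePart_iff hS).1 hP).2 T hT𝒮).1.not_gt
    (coshDist_lt_coshDist_of_normalize_eq_barrier hS hT hne hP.1 h)

lemma mem_activePart_iff_ellipseCoth_le (hS : ‖S‖ < ρ) (h𝒮 : ∀ T ∈ 𝒮, ‖T‖ ≠ ρ)
    (hP : P ∈ beachEllipse S ρ) : P ∈ activePart 𝒮 S ρ ↔
      ∀ T ∈ 𝒮, ‖T‖ < ρ → ellipseCoth S ρ (dir P) ≤ ellipseCoth T ρ (dir P) := by
  rw [mem_activePart_iff hS, and_iff_right hP]
  refine forall₂_congr fun T hT => ?_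
  rcases (h𝒮 T hT).lt_or_gt with hTρ | hTρ
  · rw [coshDist_le_coshDist_iff hS hTρ ((mem_beachEllipse_iff_of_norm_lt hS).1 hP)]
    exact ⟨fun h _ => h.1, fun h => ⟨h hTρ, fun h' => absurd hTρ h'.not_gt⟩⟩
  · exact iff_of_true ((not_exists_farther_iff hS hP T).1 fun h => absurd hTρ h.not_gt)
      fun h => absurd hTρ h.not_gt

lemma exists_isPreconnected_directions (hS : ‖S‖ < r₁) (hr : r₁ ≤ r₂)
    (h𝒮 : ∀ T ∈ 𝒮, ‖T‖ ∉ Icc r₁ r₂) (hK : IsPreconnected K)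
    (hactive : ∀ P ∈ K, ∃ ρ ∈ Icc r₁ r₂, P ∈ activePart 𝒮 S ρ) (hP : P ∈ K) (hQ : Q ∈ K)
    (hP₂ : P ∈ activePart 𝒮 S r₂) (hQ₂ : Q ∈ activePart 𝒮 S r₂) :
    ∃ N, IsPreconnected N ∧ dir P ∈ N ∧ dir Q ∈ N ∧ ∀ e ∈ N, ‖e‖ = 1 ∧
      ∀ T ∈ 𝒮, ‖T‖ < r₂ → ellipseCoth S r₂ e ≤ ellipseCoth T r₂ e := by
  have hS₂ := hS.trans_le hr
  have hK₀ (A : ℂ) (hA : A ∈ K) : A ≠ 0 := by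
    obtain ⟨ρ, hρ, hAρ⟩ := hactive A hA
    exact ne_zero_of_mem_beachEllipse (hS.trans_le hρ.1) hAρ.1
  have hle {A : ℂ} (hA : A ∈ activePart 𝒮 S r₂) (T : ℂ) (hT : T ∈ 𝒮) (hT₂ : ‖T‖ < r₂) :
      0 ≤ (ellipseCoth T r₂ - ellipseCoth S r₂) (dir A) :=
    sub_nonneg.2 ((mem_activePart_iff_ellipseCoth_le hS₂
      (fun T hT h => h𝒮 T hT ⟨h ▸ hr, h.le⟩) hA.1).1 hA T hT hT₂)
  obtain ⟨N, hN, hPN, hQN, hNle⟩ := exists_isPreconnected_unit_subset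
    (ι := {T // T ∈ 𝒮 ∧ T ≠ S ∧ ‖T‖ < r₂}) (w := fun T => barrier S T)
    (hK.image _ fun A hA => (continuousAt_normalize (hK₀ A hA)).continuousWithinAt)
    (by
      rintro _ ⟨A, hA, rfl⟩
      exact norm_normalize (hK₀ A hA))
    (mem_image_of_mem _ hP) (mem_image_of_mem _ hQ)
    (by
      rintro ⟨T, hT, hne, hT₂⟩ ⟨A, hA, hdir⟩
      obtain ⟨ρ, hρ, hAρ⟩ := hactive A hA
      have hTρ : ‖T‖ < ρ := (not_le.1 fun h => h𝒮 T hT ⟨h, hT₂.le⟩ : ‖T‖ < r₁).trans_le hρ.1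
      exact normalize_ne_barrier (hS.trans_le hρ.1) hTρ hT hne hAρ hdir)
    (fun T => norm_barrier T.2.2.1)
    (fun T => sub_neg.2 (ellipseCoth_barrier_lt hS₂ T.2.2.2 T.2.2.1))
    (fun T => hle hP₂ T T.2.1 T.2.2.2) (fun T => hle hQ₂ T T.2.1 T.2.2.2)
  refine ⟨N, hN, hPN, hQN, fun e he => ⟨(hNle e he).1, fun T hT hT₂ => ?_⟩⟩
  rcases eq_or_ne T S with rfl | hne
  · exact le_rfl
  · exact sub_nonneg.1 ((hNle e he).2 ⟨T, hT, hne, hT₂⟩)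

lemma exists_isPreconnected_subset_activePart (hS : ‖S‖ < r₁) (hr : r₁ ≤ r₂)
    (h𝒮 : ∀ T ∈ 𝒮, ‖T‖ ∉ Icc r₁ r₂) (hK : IsPreconnected K)
    (hactive : ∀ P ∈ K, ∃ ρ ∈ Icc r₁ r₂, P ∈ activePart 𝒮 S ρ) (hP : P ∈ K) (hQ : Q ∈ K)
    (hP₂ : P ∈ activePart 𝒮 S r₂) (hQ₂ : Q ∈ activePart 𝒮 S r₂) :
    ∃ N ⊆ activePart 𝒮 S r₂, IsPreconnected N ∧ P ∈ N ∧ Q ∈ N := by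
  have hS₂ := hS.trans_le hr
  obtain ⟨N, hN, hPN, hQN, hNle⟩ :=
    exists_isPreconnected_directions hS hr h𝒮 hK hactive hP hQ hP₂ hQ₂
  refine ⟨ellipsePoint S r₂ '' N, ?_, hN.image _ fun e he =>
    (continuousAt_ellipsePoint hS₂ (hNle e he).1).continuousWithinAt,
    ⟨_, hPN, ellipsePoint_normalize_of_mem hS₂ hP₂.1⟩,
    ⟨_, hQN, ellipsePoint_normalize_of_mem hS₂ hQ₂.1⟩⟩
  rintro _ ⟨e, he, rfl⟩
  obtain ⟨he₁, hle⟩ := hNle e he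
  rw [mem_activePart_iff_ellipseCoth_le hS₂ (fun T hT h => h𝒮 T hT ⟨h ▸ hr, h.le⟩)
    (ellipsePoint_mem_beachEllipse hS₂ he₁), normalize_ellipsePoint hS₂ he₁]
  exact hle

lemma eq_of_isPreconnected {A : Set ℂ} (hC : C ∈ activeSegments 𝒮 S ρ)
    (hD : D ∈ activeSegments 𝒮 S ρ) (hA : IsPreconnected A) (hAactive : A ⊆ activePart 𝒮 S ρ)
    (hP : P ∈ A) (hQ : Q ∈ A) (hPC : P ∈ C) (hQD : Q ∈ D) : D = C := by
  obtain ⟨-, P', -, rfl⟩ := hC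
  obtain ⟨-, Q', -, rfl⟩ := hD
  rw [connectedComponentIn_eq hPC, connectedComponentIn_eq hQD]
  exact (connectedComponentIn_eq (hA.subset_connectedComponentIn hP hAactive hQ)).symm

lemma Continues.eq (hS : ‖S‖ < r₁) (hr : r₁ ≤ r₂) (h𝒮 : ∀ T ∈ 𝒮, ‖T‖ ∉ Icc r₁ r₂)
    (hC' : C' ∈ activeSegments 𝒮 S r₁) (hC : C ∈ activeSegments 𝒮 S r₂)
    (hD : D ∈ activeSegments 𝒮 S r₂) (hCC' : Continues 𝒮 S r₁ C' r₂ C)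
    (hDC' : Continues 𝒮 S r₁ C' r₂ D) : D = C := by
  obtain ⟨γ, hγ, hγactive, hγC', hγC⟩ := hCC'
  obtain ⟨δ, hδ, hδactive, hδC', hδD⟩ := hDC'
  have hr₁ : r₁ ∈ Icc r₁ r₂ := left_mem_Icc.2 hr
  have hr₂ : r₂ ∈ Icc r₁ r₂ := right_mem_Icc.2 hr
  have hK : IsPreconnected (γ '' Icc r₁ r₂ ∪ C' ∪ δ '' Icc r₁ r₂) :=
    ((isPreconnected_Icc.image γ hγ).union _ (mem_image_of_mem γ hr₁) hγC'
      (isPreconnected_of_mem_activeSegments hC')).union _ (Or.inr hδC') (mem_image_of_mem δ hr₁)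
      (isPreconnected_Icc.image δ hδ)
  have hactive : ∀ P ∈ γ '' Icc r₁ r₂ ∪ C' ∪ δ '' Icc r₁ r₂,
      ∃ ρ ∈ Icc r₁ r₂, P ∈ activePart 𝒮 S ρ := by
    have hpath {η : ℝ → ℂ} (hη : ∀ ρ ∈ Icc r₁ r₂, ∃ D ∈ activeSegments 𝒮 S ρ, η ρ ∈ D)
        (ρ : ℝ) (hρ : ρ ∈ Icc r₁ r₂) : η ρ ∈ activePart 𝒮 S ρ := by
      obtain ⟨D, hD, hηD⟩ := hη ρ hρ
      exact subset_activePart_of_mem_activeSegments hD hηD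
    rintro P ((⟨ρ, hρ, rfl⟩ | hP) | ⟨ρ, hρ, rfl⟩)
    · exact ⟨ρ, hρ, hpath hγactive ρ hρ⟩
    · exact ⟨r₁, hr₁, subset_activePart_of_mem_activeSegments hC' hP⟩
    · exact ⟨ρ, hρ, hpath hδactive ρ hρ⟩
  obtain ⟨N, hNactive, hN, hγN, hδN⟩ := exists_isPreconnected_subset_activePart hS hr h𝒮 hK hactive
    (Or.inl (Or.inl (mem_image_of_mem γ hr₂))) (Or.inr (mem_image_of_mem δ hr₂))
    (subset_activePart_of_mem_activeSegments hC hγC)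
    (subset_activePart_of_mem_activeSegments hD hδD)
  exact eq_of_isPreconnected hC hD hN hNactive hγN hδN hγC hδD

lemma norm_le_of_mem_activeSegments (hC : C ∈ activeSegments 𝒮 S ρ) : ‖S‖ ≤ ρ := by
  obtain ⟨-, P, hP, -⟩ := hC
  exact norm_le_of_mem_beachEllipse hP.1

lemma BecameActive.exists_site (hS : S ∈ 𝒮) (hr : r₁ ≤ r₂) (h : BecameActive 𝒮 S r₁ r₂ C) :
    ∃ T ∈ 𝒮, r₁ ≤ ‖T‖ ∧ ‖T‖ ≤ r₂ := by
  by_contra! h𝒮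
  have hS₁ : ‖S‖ < r₁ := not_le.1 fun h₁ =>
    (h𝒮 S hS h₁).not_ge (norm_le_of_mem_activeSegments h.1)
  obtain ⟨C', hC', hCC'⟩ := exists_continues hS₁ hr h.1
  exact h.2 ⟨C', hC', hCC', fun D hD hDC' => hCC'.eq hS₁ hr
    (fun T hT hTr => (h𝒮 T hT hTr.1).not_ge hTr.2) hC' h.1 hD hDC'⟩

end Barrier

section CircleEvents

variable {𝒮 : Finset ℂ} {P S T U V : ℂ} {d r ρ : ℝ}

lemma exists_isFarPoint (hV : V ≠ 0) (hd : 0 ≤ d) : ∃ V', IsFarPoint V d V' ∧ ‖V'‖ = ‖V‖ + d := by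
  have hpos : 0 < ‖V‖ + d := add_pos_of_pos_of_nonneg (norm_pos_iff.2 hV) hd
  have hnorm : ‖(‖V‖ + d) • dir V‖ = ‖V‖ + d := by
    rw [norm_smul, norm_normalize hV, mul_one, Real.norm_of_nonneg hpos.le]
  have hray : SameRay ℝ V ((‖V‖ + d) • dir V) := by
    nth_rewrite 1 [← norm_smul_normalize V]
    exact (SameRay.sameRay_nonneg_smul_left _ (norm_nonneg V)).nonneg_smul_right hpos.le
  refine ⟨_, ⟨(hypDist_eq_iff hd).2 ?_, fun Q hQ => ?_⟩, hnorm⟩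
  · rw [coshDist_eq_cosh_norm_sub_iff.2 hray, hnorm, sub_add_cancel_left, Real.cosh_neg]
  · have habs := Real.cosh_le_cosh.1
      ((cosh_norm_sub_le_coshDist V Q).trans_eq ((hypDist_eq_iff hd).1 hQ))
    rw [hnorm]
    linarith [neg_le_of_abs_le habs, abs_of_nonneg hd]

lemma IsVoronoiVertex.norm_add_mem_eventRadii (h : IsVoronoiVertex 𝒮 V d) (hV : V ≠ 0)
    (hd : 0 ≤ d) : ((‖V‖ + d : ℝ) : EReal) ∈ eventRadii 𝒮 := by
  obtain ⟨V', hV', hnorm⟩ := exists_isFarPoint hV hd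
  exact Or.inr ⟨V, d, V', h, hV', by rw [hnorm]⟩

lemma isVoronoiVertex_of_mem_beachEllipse (hP : P ∈ beachEllipse S ρ)
    (hmin : ∀ U ∈ 𝒮, coshDist P S ≤ coshDist P U) (hS : S ∈ 𝒮) (hT : T ∈ 𝒮) (hU : U ∈ 𝒮)
    (hST : S ≠ T) (hSU : S ≠ U) (hTU : T ≠ U) (hPT : coshDist P T = coshDist P S)
    (hPU : coshDist P U = coshDist P S) : IsVoronoiVertex 𝒮 P (ρ - ‖P‖) := by
  obtain ⟨hPρ, hPS⟩ := mem_beachEllipse_iff.1 hP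
  have hd := sub_nonneg.2 hPρ
  refine ⟨fun A hA => (le_hypDist_iff hd).2 (hPS ▸ hmin A hA),
    (two_lt_ncard_iff (𝒮.finite_toSet.subset fun A hA => hA.1)).2 ⟨S, T, U, ⟨hS, ?_⟩, ⟨hT, ?_⟩,
      ⟨hU, ?_⟩, hST, hSU, hTU⟩⟩
  · exact (hypDist_eq_iff hd).2 hPS
  · exact (hypDist_eq_iff hd).2 (hPT.trans hPS)
  · exact (hypDist_eq_iff hd).2 (hPU.trans hPS)

lemma coshDist_le_of_mem_beachCurve (h𝒮 : ∀ T ∈ 𝒮, ‖T‖ ≠ ρ)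
    (hPS : P ∈ beachEllipse S ρ) (hP : P ∈ beachCurve 𝒮 ρ) (hU : U ∈ 𝒮) :
    coshDist P S ≤ coshDist P U := by
  obtain ⟨T, ⟨hT, hTρ⟩, hPT⟩ := mem_iUnion₂.1 hP
  rw [(mem_beachEllipse_iff.1 hPS).2, ← (mem_beachEllipse_iff.1 hPT.1).2]
  exact (((mem_activePart_iff (hTρ.lt_of_ne (h𝒮 T hT))).1 hPT).2 U hU).1

lemma mem_beachCurve_of_equidistant (hS : ‖S‖ < ρ) (hT : ‖T‖ < ρ) (hS𝒮 : S ∈ 𝒮)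
    (hPS : P ∈ beachEllipse S ρ) (hPT : coshDist P S = coshDist P T)
    (hlt : ∀ U ∈ 𝒮, U ≠ S → U ≠ T → coshDist P S < coshDist P U) : P ∈ beachCurve 𝒮 ρ := by
  refine mem_iUnion₂.2 ⟨S, ⟨hS𝒮, hS.le⟩, (mem_activePart_iff hS).2 ⟨hPS, fun U hU => ?_⟩⟩
  rcases eq_or_ne U S with rfl | hUS
  · exact ⟨le_rfl, fun h => absurd hS h.not_gt⟩
  rcases eq_or_ne U T with rfl | hUT
  · exact ⟨hPT.le, fun h => absurd hT h.not_gt⟩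
  · exact ⟨(hlt U hU hUS hUT).le, fun _ => hlt U hU hUS hUT⟩

lemma IntersectionEntersAt.exists_equidistant (h : IntersectionEntersAt 𝒮 S T r)
    (hSr : ‖S‖ < r) (hTr : ‖T‖ < r) (h𝒮 : ∀ U ∈ 𝒮, ‖U‖ ≠ r) (hS : S ∈ 𝒮) :
    ∃ P ∈ beachEllipse S r ∩ beachEllipse T r, (∀ U ∈ 𝒮, coshDist P S ≤ coshDist P U) ∧
      ∃ U ∈ 𝒮, U ≠ S ∧ U ≠ T ∧ coshDist P U = coshDist P S := by
  obtain ⟨ε, hε, I, hI, hIST, hbefore, hIr⟩ := h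
  have hr : r ∈ Icc (r - ε) r := ⟨by linarith, le_rfl⟩
  have hmin (U : ℂ) (hU : U ∈ 𝒮) := coshDist_le_of_mem_beachCurve h𝒮 (hIST r hr).1 hIr hU
  refine ⟨I r, hIST r hr, hmin, ?_⟩
  by_contra! hU
  have hcont (A : ℂ) : ContinuousWithinAt (fun ρ => coshDist (I ρ) A) (Ico (r - ε) r) r :=
    (continuous_coshDist_left A).continuousAt.comp_continuousWithinAt
      ((hI r hr).mono Ico_subset_Icc_self)
  have hlt : ∀ᶠ ρ in 𝓝[Ico (r - ε) r] r,
      ∀ U ∈ 𝒮, U ≠ S → U ≠ T → coshDist (I ρ) S < coshDist (I ρ) U := by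
    refine (Finset.eventually_all 𝒮).2 fun U hU𝒮 => ?_
    simp only [eventually_imp_distrib_left]
    exact fun hUS hUT =>
      (hcont S).eventually_lt (hcont U) ((hmin U hU𝒮).lt_of_ne' (hU U hU𝒮 hUS hUT))
  have hST : ∀ᶠ ρ in 𝓝[Ico (r - ε) r] r, ‖S‖ < ρ ∧ ‖T‖ < ρ :=
    eventually_nhdsWithin_of_eventually_nhds ((lt_mem_nhds hSr).and (lt_mem_nhds hTr))
  have : (𝓝[Ico (r - ε) r] r).NeBot := right_nhdsWithin_Ico_neBot (sub_lt_self r hε)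
  obtain ⟨ρ, hltρ, ⟨hSρ, hTρ⟩, hρ⟩ := (hlt.and (hST.and self_mem_nhdsWithin)).exists
  obtain ⟨hIS, hIT⟩ := hIST ρ (Ico_subset_Icc_self hρ)
  exact hbefore ρ hρ (mem_beachCurve_of_equidistant hSρ hTρ hS hIS
    ((mem_beachEllipse_iff.1 hIS).2.trans (mem_beachEllipse_iff.1 hIT).2.symm) hltρ)

lemma IntersectionEntersAt.mem_eventRadii (h : IntersectionEntersAt 𝒮 S T r) (hS : S ∈ 𝒮)
    (hT : T ∈ 𝒮) (hST : S ≠ T) : (r : EReal) ∈ eventRadii 𝒮 := by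
  by_cases h𝒮 : ∃ U ∈ 𝒮, ‖U‖ = r
  · obtain ⟨U, hU, rfl⟩ := h𝒮
    exact Or.inl (Or.inr ⟨U, hU, rfl⟩)
  push Not at h𝒮
  obtain ⟨hSr, hTr⟩ : ‖S‖ < r ∧ ‖T‖ < r := by
    obtain ⟨ε, hε, I, -, hI, -⟩ := h
    obtain ⟨hIS, hIT⟩ := hI r ⟨by linarith, le_rfl⟩
    exact ⟨(norm_le_of_mem_beachEllipse hIS).lt_of_ne (h𝒮 S hS),
      (norm_le_of_mem_beachEllipse hIT).lt_of_ne (h𝒮 T hT)⟩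
  obtain ⟨P, ⟨hPS, hPT⟩, hmin, U, hU, hUS, hUT, hPU⟩ := h.exists_equidistant hSr hTr h𝒮 hS
  have hvertex := isVoronoiVertex_of_mem_beachEllipse hPS hmin hS hT hU hST hUS.symm hUT.symm
    ((mem_beachEllipse_iff.1 hPT).2.trans (mem_beachEllipse_iff.1 hPS).2.symm) hPU
  have := hvertex.norm_add_mem_eventRadii (ne_zero_of_mem_beachEllipse hSr hPS)
    (sub_nonneg.2 hPS.1)
  rwa [add_sub_cancel] at this

end CircleEvents

end HyperbolicSweep

end

theorem mainTheorem3 (𝒮 : Finset ℂ) :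
    -- a segment becomes active only through a site event
    (∀ S ∈ 𝒮, ∀ r₁ r₂ : ℝ, r₁ < r₂ → ∀ C : Set ℂ, BecameActive 𝒮 S r₁ r₂ C →
      ∃ T ∈ 𝒮, r₁ ≤ ‖T‖ ∧ ‖T‖ ≤ r₂) ∧
    -- if it is not even a part of an earlier segment, then the event is that of its own site
    (∀ S ∈ 𝒮, ∀ r₁ r₂ : ℝ, r₁ < r₂ → ∀ C ∈ activeSegments 𝒮 S r₂,
      (¬ ∃ C' ∈ activeSegments 𝒮 S r₁, Continues 𝒮 S r₁ C' r₂ C) →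
      r₁ ≤ ‖S‖ ∧ ‖S‖ ≤ r₂) ∧
    -- no intersection enters the beach curve between consecutive events
    (∀ rᵢ ∈ eventRadii 𝒮, ∀ rⱼ ∈ eventRadii 𝒮,
      (∀ q ∈ eventRadii 𝒮, ¬ (rᵢ < q ∧ q < rⱼ)) →
      ∀ r : ℝ, rᵢ < (r : EReal) → (r : EReal) < rⱼ →
      ∀ S ∈ 𝒮, ∀ T ∈ 𝒮, S ≠ T → ¬ IntersectionEntersAt 𝒮 S T r) := by
  refine ⟨fun S hS r₁ r₂ hr C hC => hC.exists_site hS hr.le, fun S _ r₁ r₂ hr C hC hnew => ?_, ?_⟩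
  · refine ⟨?_, norm_le_of_mem_activeSegments hC⟩
    by_contra! hS
    exact hnew (exists_continues hS hr.le hC)
  · intro rᵢ _ rⱼ _ hconsecutive r hri hrj S hS T hT hST hI
    exact hconsecutive r (hI.mem_eventRadii hS hT hST) ⟨hri, hrj⟩
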